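/- Let $n\ge 0$, let $x_1,\dots,x_n$ be variables of degrees $c_1,\dots,c_n\in\mathbb{Q}$ with $0<c_i<1$, and set $N=\prod_{i=1}^n\frac{1-c_i}{c_i}$. Let $\mathcal{M}_{\mathrm{mar}}^\circ$ be the set of weighted homogeneous polynomials $g\in\mathbb{C}[x_1,\dots,x_n]$ of degree $1$ whose partial derivatives $\partial_{x_1}g,\dots,\partial_{x_n}g$ form a regular sequence in $\mathbb{C}[x_1,\dots,x_n]$, and assume that $\mathcal{M}_{\mathrm{mar}}^\circ\ne\emptyset$. Let $\mathcal{M}$ be the set of polynomials $f=\sum_{0<d\le 1}f_d$ with $f_d$ weighted homogeneous of degree $d$ and $f_1\in\mathcal{M}_{\mathrm{mar}}^\circ$. Then: (0) $\mathcal{M}$ is Zariski open in the affine space of all polynomials $\sum_m t_m x^m$, where $m$ runs through the finitely many exponents for which $x^m$ has degree in $(0,1]$; regard $\mathcal{M}$ as an open subscheme of this affine space. Moreover $N$ is a non-negative integer. Let $f(x;t)=\sum_m t_m x^m$ be the universal polynomial on $X=\mathbb{C}^n\times\mathcal{M}$, let $\pi\colon X\to\mathcal{M}$ be the projection, and let $\Omega^k[z]$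 denote $\pi_*\Omega^k_{X/\mathcal{M}}[z]$, where $\Omega^k_{X/\mathcal{M}}$ is the sheaf of relative algebraic $k$-forms. Then: (1) The sheaf $\mathcal{F}=\Omega^n[z]/(z\,d_{X/\mathcal{M}}+d_{X/\mathcal{M}}f\wedge)\,\Omega^{n-1}[z]$ is a locally free $\mathcal{O}_{\mathcal{M}}[z]$-module of rank $N$: every point of $\mathcal{M}$ has an open neighbourhood $U\subset\mathcal{M}$ with $\mathcal{F}|_U\cong(\mathcal{O}_U[z])^{\oplus N}$ as $\mathcal{O}_U[z]$-modules. (2) Let $C\subset X$ be the closed subscheme defined by the ideal $(\partial_{x_1}f(x;t),\dots,\partial_{x_n}f(x;t))$. Then $\pi_*\mathcal{O}_C$ is a locally free $\mathcal{O}_{\mathcal{M}}$-module of rank $N$. -/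

import Mathlib

open CategoryTheory AlgebraicGeometry

noncomputable section

namespace LandauGinzburg

/-! ### Algebraic differential forms on affine space and the twisted differential -/

section Forms

variable (B : Type) [CommRing B] (n : ℕ)

/-- The module `Ω^k` of algebraic `k`-forms on `𝔸ⁿ_B`, relative to `B`: the `k`-th exterior power
of the Kähler differentials of the polynomial ring `B[x₁, …, xₙ]` over `B`. -/
abbrev Forms (k : ℕ) : Type :=
  ⋀[MvPolynomial (Fin n) B]^k (Ω[MvPolynomial (Fin n) B⁄B])

/-- The basis `dx_I = dx_{i₁} ∧ … ∧ dx_{iₖ}`, for `I = {i₁ < … < iₖ}`, of `Ω^k`. -/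
def dxBasis (k : ℕ) :
    Module.Basis (Set.powersetCard (Fin n) k) (MvPolynomial (Fin n) B) (Forms B n k) :=
  (KaehlerDifferential.mvPolynomialBasis B (Fin n)).exteriorPower k

/-- Left exterior multiplication by a `1`-form, `η ↦ ω ∧ η`, from `Ω^k` to `Ω^{k+1}`. -/
def wedgeLeft (k : ℕ) (ω : Ω[MvPolynomial (Fin n) B⁄B]) :
    Forms B n k →ₗ[MvPolynomial (Fin n) B] Forms B n (k + 1) :=
  (LinearMap.mulLeft (MvPolynomial (Fin n) B)
    (ExteriorAlgebra.ι (MvPolynomial (Fin n) B) ω)).restrict (fun x hx => by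
      change _ * x ∈ _ ^ (k + 1)
      rw [pow_succ']
      exact Submodule.mul_mem_mul (LinearMap.mem_range_self _ ω) hx)

/-- The exterior derivative `d : Ω^k → Ω^{k+1}` relative to `B`:
`d (∑_I g_I dx_I) = ∑_I dg_I ∧ dx_I`. It is `B`-linear. -/
def extDeriv (k : ℕ) : Forms B n k →ₗ[B] Forms B n (k + 1) where
  toFun ω := ∑ I, wedgeLeft B n k
    (KaehlerDifferential.D B (MvPolynomial (Fin n) B) ((dxBasis B n k).repr ω I))
    (dxBasis B n k I)
  map_add' ω η := by
    rw [← Finset.sum_add_distrib]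
    refine Finset.sum_congr rfl fun I _ => Subtype.ext ?_
    simp [wedgeLeft, add_mul]
  map_smul' b ω := by
    rw [RingHom.id_apply, Finset.smul_sum]
    refine Finset.sum_congr rfl fun I _ => Subtype.ext ?_
    have h : (dxBasis B n k).repr (b • ω) I = b • (dxBasis B n k).repr ω I := by
      rw [← algebraMap_smul (MvPolynomial (Fin n) B) b ω, map_smul, Finsupp.smul_apply,
        algebraMap_smul]
    rw [h, Derivation.map_smul]
    have h2 : ∀ ω : Ω[MvPolynomial (Fin n) B⁄B],
        ExteriorAlgebra.ι (MvPolynomial (Fin n) B) (b • ω) =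
          b • ExteriorAlgebra.ι (MvPolynomial (Fin n) B) ω := fun ω => by
      rw [← algebraMap_smul (MvPolynomial (Fin n) B) b ω, map_smul, algebraMap_smul]
    simp [wedgeLeft, h2]

/-- The twisted differential `z d + df ∧ : Ω^k → Ω^{k+1}`, for `z ∈ B` and `f ∈ B[x]`. -/
def twistedDiff (z : B) (f : MvPolynomial (Fin n) B) (k : ℕ) :
    Forms B n k →ₗ[B] Forms B n (k + 1) :=
  z • extDeriv B n k +
    (wedgeLeft B n k (KaehlerDifferential.D B (MvPolynomial (Fin n) B) f)).restrictScalars B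

/-- The image `(z d + df ∧) Ω^{k-1}` inside `Ω^k` (with `Ω^{-1} = 0`). -/
def twistedExact (z : B) (f : MvPolynomial (Fin n) B) :
    (k : ℕ) → Submodule B (Forms B n k)
  | 0 => ⊥
  | k + 1 => LinearMap.range (twistedDiff B n z f k)

/-- The top twisted de Rham cohomology `Ω^n / (z d + df ∧) Ω^{n-1}` of `f` on `𝔸ⁿ_B`,
a module over `B`. -/
abbrev TwistedDeRham (z : B) (f : MvPolynomial (Fin n) B) : Type :=
  Forms B n n ⧸ twistedExact B n z f n

end Forms

/-! ### Locally free sheaves of finite rank -/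

/-- Let `p : Y ⟶ S` be a morphism of schemes, `G` a sheaf of `𝒪_Y`-modules and `M ⊆ S` open.
The sheaf `p_* G` of `p_* 𝒪_Y`-modules is *locally free of rank `N` over `M`* if every point of `M`
has an open neighbourhood `U ⊆ M` with sections `s₁, …, s_N ∈ (p_* G)(U)` for which
`(p_* 𝒪_Y)^N ⟶ p_* G` is an isomorphism over `U`, that is: for every open `V ⊆ U`, the
restrictions of the `sᵢ` form a basis of the `(p_* 𝒪_Y)(V)`-module `(p_* G)(V)`. -/
def IsLocallyFreeOfRankOver {Y S : Scheme.{0}} (p : Y ⟶ S) (G : Y.Modules) (M : S.Opens)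
    (N : ℕ) : Prop :=
  ∀ x ∈ M, ∃ U : S.Opens, x ∈ U ∧ U ≤ M ∧ ∃ s : Fin N → Γ(G, p ⁻¹ᵁ U),
    ∀ (V : S.Opens) (hVU : V ≤ U),
      let sV : Fin N → Γ(G, p ⁻¹ᵁ V) :=
        fun i => G.presheaf.map (homOfLE (p.preimage_mono hVU)).op (s i)
      LinearIndependent Γ(Y, p ⁻¹ᵁ V) sV ∧ Submodule.span Γ(Y, p ⁻¹ᵁ V) (Set.range sV) = ⊤

/-! ### The family of polynomials -/

/-- Rational weights `c₁, …, cₙ` of the variables with `0 < cᵢ < 1`. -/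
structure WeightSystem (n : ℕ) where
  /-- the degree of the `i`-th variable -/
  c : Fin n → ℚ
  pos : ∀ i, 0 < c i
  lt_one : ∀ i, c i < 1

namespace WeightSystem

variable {n : ℕ} (W : WeightSystem n)

/-- The exponents of the monomials of degree `> 0` and `≤ 1`. -/
abbrev Exps : Type :=
  {m : Fin n →₀ ℕ // 0 < Finsupp.weight W.c m ∧ Finsupp.weight W.c m ≤ 1}

instance : Finite W.Exps := by
  have hfin : (Set.Iic (Finsupp.equivFunOnFinite.symm
      (fun i => ⌊(W.c i)⁻¹⌋₊) : Fin n →₀ ℕ)).Finite := Set.finite_Iic _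
  refine (hfin.subset ?_).to_subtype
  intro m hm i
  have h1 : Finsupp.weight W.c m ≤ 1 := hm.2
  rw [Finsupp.weight_apply, Finsupp.sum_fintype _ _ (by simp)] at h1
  have h2 : (m i : ℚ) * W.c i ≤ 1 := by
    refine le_trans ?_ h1
    have := Finset.single_le_sum (f := fun j => m j • W.c j) (s := Finset.univ)
      (fun j _ => nsmul_nonneg (W.pos j).le _) (Finset.mem_univ i)
    simpa using this
  simp only [Finsupp.equivFunOnFinite_symm_apply_apply]
  apply Nat.le_floor
  rw [← one_div, le_div_iff₀ (W.pos i)]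
  exact h2

instance : Fintype W.Exps := Fintype.ofFinite _

/-- A polynomial in `𝓜_mar` (weighted homogeneous of degree one) whose partial derivatives form a
regular sequence: an element of `𝓜_mar°`. -/
def IsRegularMarginal (g : MvPolynomial (Fin n) ℂ) : Prop :=
  MvPolynomial.IsWeightedHomogeneous W.c g 1 ∧
    RingTheory.Sequence.IsRegular (MvPolynomial (Fin n) ℂ)
      (List.ofFn fun i => MvPolynomial.pderiv i g)

/-- The set of polynomials `f = ∑_{0 < d ≤ 1} f_d`, `deg f_d = d`, with `f₁ ∈ 𝓜_mar°`. -/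
def polySet : Set (MvPolynomial (Fin n) ℂ) :=
  {f | (∀ m ∈ f.support, 0 < Finsupp.weight W.c m ∧ Finsupp.weight W.c m ≤ 1) ∧
    W.IsRegularMarginal (MvPolynomial.weightedHomogeneousComponent W.c 1 f)}

/-- The polynomial `∑ₘ tₘ xᵐ` with coefficient vector `t`, where `m` runs through the monomials of
degree `> 0` and `≤ 1`. -/
def poly {R : Type} [CommRing R] (t : W.Exps → R) : MvPolynomial (Fin n) R :=
  ∑ m : W.Exps, MvPolynomial.monomial m.1 (t m)

/-- The coordinate ring `ℂ[tₘ]` of the affine space of all polynomials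
`∑ₘ tₘ xᵐ` with monomials of degree `> 0` and `≤ 1`. -/
abbrev Coord : Type := MvPolynomial W.Exps ℂ

/-- The affine space of all polynomials `∑ₘ tₘ xᵐ` with monomials of degree `> 0` and `≤ 1`. -/
abbrev Param : Scheme.{0} := Spec (CommRingCat.of W.Coord)

/-- The closed point of the affine space given by the coefficient vector `t`. -/
def point (t : W.Exps → ℂ) : W.Param :=
  (⟨RingHom.ker (MvPolynomial.eval t), RingHom.ker_isPrime _⟩ : PrimeSpectrum W.Coord)

/-- The parameter space `𝓜`, as an open subscheme of the affine space of coefficients: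
the largest open subset all of whose `ℂ`-points are polynomials with regular leading term. -/
def modSpace : W.Param.Opens :=
  sSup {U | ∀ t : W.Exps → ℂ, W.point t ∈ U → W.poly t ∈ W.polySet}

/-- The universal polynomial `f(x; t) = ∑ₘ tₘ xᵐ`. -/
def universalPoly : MvPolynomial (Fin n) W.Coord :=
  W.poly (fun m => MvPolynomial.X m)

/-! ### The twisted de Rham sheaf

With `A = ℂ[tₘ]`, the `A[z]`-module `Ω^k_{A[x]/A}[z]` is `Ω^k_{A[z][x]/A[z]}`, so the forms of the
previous section are used over the base `B = A[z]`. -/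

/-- The product of the affine space of coefficients with the affine line with coordinate `z`. -/
abbrev ParamZ : Scheme.{0} := Spec (CommRingCat.of (Polynomial W.Coord))

/-- The projection forgetting `z`. The sheaf of rings `𝒪[z]` is `(projZ)_* 𝒪`. -/
def projZ : W.ParamZ ⟶ W.Param :=
  Spec.map (CommRingCat.ofHom (Polynomial.C : W.Coord →+* Polynomial W.Coord))

/-- The universal polynomial, regarded as a polynomial over `ℂ[tₘ][z]`. -/
def universalPolyZ : MvPolynomial (Fin n) (Polynomial W.Coord) :=
  MvPolynomial.map Polynomial.C W.universalPoly

/-- The quasi-coherent sheaf `Ω^n[z] / (z d + df ∧) Ω^{n-1}[z]` for the universal polynomial, on the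
product of the affine space of coefficients and the `z`-line. Its pushforward along `projZ`,
restricted to `𝓜`, is the `𝒪_𝓜[z]`-module `ℱ`. -/
def twistedSheaf : W.ParamZ.Modules :=
  tilde (ModuleCat.of (CommRingCat.of (Polynomial W.Coord))
    (TwistedDeRham (Polynomial W.Coord) n Polynomial.X W.universalPolyZ))

/-! ### The Jacobi sheaf -/

/-- The ideal of the relative partial derivatives `∂f/∂xᵢ` of the universal polynomial. -/
def jacIdeal : Ideal (MvPolynomial (Fin n) W.Coord) :=
  Ideal.span (Set.range fun i => MvPolynomial.pderiv i W.universalPoly)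

/-- The relative critical scheme of the universal polynomial. Its part over `𝓜` is `C`. -/
abbrev critScheme : Scheme.{0} :=
  Spec (CommRingCat.of (MvPolynomial (Fin n) W.Coord ⧸ W.jacIdeal))

/-- The projection `π` from the critical scheme to the parameter space. -/
def critProj : W.critScheme ⟶ W.Param :=
  Spec.map (CommRingCat.ofHom ((Ideal.Quotient.mk W.jacIdeal).comp MvPolynomial.C))

/-- The sheaf `π_* 𝒪_C` of `𝒪`-modules on the parameter space. -/
def jacobiSheaf : W.Param.Modules :=
  (Scheme.Modules.pushforward W.critProj).obj
    (SheafOfModules.unit W.critScheme.ringCatSheaf : W.critScheme.Modules)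

end WeightSystem

end LandauGinzburg

end

/-! After scaling by a common denominator `L`, the variables have integer weights `v i`, the
derivatives of the leading form `F` (the degree-one part of `f`) have degrees `e i = L - v i`, and N
= ∏ e i / ∏ v i.

At a point where the derivatives of `F` form a regular sequence, the Jacobian ring of `F` has
Hilbert series ∏ (1 - X^(e i)) / ∏ (1 - X^(v i)). Its coefficients are non-negative, which makes it
a polynomial; its value at 1 is N, so some set `S` of N monomials is a basis
(`exists_monomialBasis`). Nakayama's lemma in bounded degrees spreads the spanning property to a
principal open set `h ≠ 0` (`exists_smul_mem_of_spansMod`). At any ℂ-point there the Hilbert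
function is at most the expected one, whereas a failure of regularity would make the first deviation
from it an excess. So equality holds, giving regularity and independence of `S`
(`regSeq_of_spansMod`). Hence 𝓜 is open, and one `S` serves a whole neighbourhood.

The leading form controls z d + df∧. In coordinates this operator is g ↦ ∑ (g_l ∂_l f + z ∂_l g_l),
with ∑ g_l ∂_l F as its part of highest weight. Spanning passes to it by induction on the weight
(`mem_awaySat_twistedDiv`). For independence, if a combination of `S` is the image of g, the top
part of g is a syzygy of the ∂_l F, hence a Koszul one; subtracting a twisted boundary lowers g
without changing its image, until g = 0 (`eq_zero_of_mem_range_twistedDiv`). This is carried out at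
ℂ-points and lifts to ℂ[t][z], because a polynomial vanishing on a non-empty principal open set is
zero. Setting z = 0 gives the Jacobi ring, so (1) and (2) are one argument.

A family that is independent and spans up to powers of `h` is a basis over each basic open set
inside D(h), and by gluing over each open subset. -/

noncomputable section

namespace LandauGinzburg

/-! ### Local freeness from bases over basic open sets. -/

section Sheaf

variable {Y S : Scheme.{0}} (p : Y ⟶ S) (G : Y.Modules) {N : ℕ}

/-- The restrictions of sections `s` of `G` over `U` to `W ≤ U` form a basis. -/
def IsBasisOn {U W : Y.Opens} (hWU : W ≤ U) (s : Fin N → Γ(G, U)) : Prop :=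
  LinearIndependent Γ(Y, W) (fun i => G.presheaf.map (homOfLE hWU).op (s i)) ∧
    Submodule.span Γ(Y, W) (Set.range fun i => G.presheaf.map (homOfLE hWU).op (s i)) = ⊤

theorem isBasisOn_iff_bijective {U W : Y.Opens} (hWU : W ≤ U) (s : Fin N → Γ(G, U)) :
    IsBasisOn G hWU s ↔ Function.Bijective fun b : Fin N → Γ(Y, W) =>
      ∑ i, b i • G.presheaf.map (homOfLE hWU).op (s i) := by
  rw [IsBasisOn, linearIndependent_iff_injective_fintypeLinearCombination,
    ← Fintype.range_linearCombination,
    LinearMap.range_eq_top]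
  rfl

theorem map_sum_smul {U W W' : Y.Opens} (hWU : W ≤ U) (h : W' ≤ W) (s : Fin N → Γ(G, U))
    (b : Fin N → Γ(Y, W)) :
    G.presheaf.map (homOfLE h).op (∑ i, b i • G.presheaf.map (homOfLE hWU).op (s i)) =
      ∑ i, Y.presheaf.map (homOfLE h).op (b i) •
        G.presheaf.map (homOfLE (h.trans hWU)).op (s i) := by
  rw [map_sum]
  refine Finset.sum_congr rfl fun i _ => ?_
  rw [Scheme.Modules.map_smul, ← ConcreteCategory.comp_apply, ← Functor.map_comp]
  rfl

/-- Being a basis can be checked on a cover which is stable under intersections. -/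
theorem IsBasisOn.of_cover {U V : Y.Opens} (hVU : V ≤ U) (s : Fin N → Γ(G, U))
    {ι : Type} (W : ι → Y.Opens) (hWV : ∀ i, W i ≤ V) (hcov : V ≤ iSup W)
    (hW : ∀ i, IsBasisOn G ((hWV i).trans hVU) s)
    (hWW : ∀ i j, IsBasisOn G ((inf_le_left.trans (hWV i)).trans hVU : W i ⊓ W j ≤ U) s) :
    IsBasisOn G hVU s := by
  simp only [isBasisOn_iff_bijective] at *
  let FY : TopCat.Sheaf CommRingCat Y := Y.sheaf
  let FG : TopCat.Sheaf Ab Y := ⟨G.presheaf, G.isSheaf⟩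
  constructor
  · intro b b' hbb
    funext k
    refine TopCat.Sheaf.eq_of_locally_eq' FY W V (fun i => homOfLE (hWV i)) hcov _ _ fun i => ?_
    have h := congrArg (G.presheaf.map (homOfLE (hWV i)).op) hbb
    simp only [map_sum_smul] at h
    exact congrFun ((hW i).1 h) k
  · intro x
    choose b hb using fun i => (hW i).2 (G.presheaf.map (homOfLE (hWV i)).op x)
    -- Injectivity on the overlap makes the local coefficients agree there; this is where `hWW`
    -- enters.
    have hcompat : ∀ i j, (fun k => Y.presheaf.map (homOfLE inf_le_left).op (b i k)) =
        (fun k => Y.presheaf.map (homOfLE (inf_le_right : W i ⊓ W j ≤ W j)).op (b j k)) := by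
      intro i j
      apply (hWW i j).1
      have hi := congrArg (G.presheaf.map (homOfLE (inf_le_left : W i ⊓ W j ≤ W i)).op) (hb i)
      have hj := congrArg (G.presheaf.map (homOfLE (inf_le_right : W i ⊓ W j ≤ W j)).op) (hb j)
      simp only [map_sum_smul] at hi hj
      refine hi.trans (Eq.trans ?_ hj.symm)
      rw [← ConcreteCategory.comp_apply, ← ConcreteCategory.comp_apply, ← Functor.map_comp,
        ← Functor.map_comp]
      rfl
    have hglue : ∀ k, ∃ c : Γ(Y, V), ∀ i, Y.presheaf.map (homOfLE (hWV i)).op c = b i k := by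
      intro k
      obtain ⟨c, hc, -⟩ := TopCat.Sheaf.existsUnique_gluing' FY W V (fun i => homOfLE (hWV i)) hcov
        (fun i => b i k) (fun i j => congrFun (hcompat i j) k)
      exact ⟨c, hc⟩
    choose c hc using hglue
    refine ⟨c, ?_⟩
    refine TopCat.Sheaf.eq_of_locally_eq' FG W V (fun i => homOfLE (hWV i)) hcov _ _ fun i => ?_
    refine (map_sum_smul G hVU (hWV i) s c).trans ?_
    simp only [hc]
    exact hb i

/-- A sheaf of modules is locally free if its sections form a basis over the basic opens. -/
theorem isLocallyFreeOfRankOver_of_basicOpen {R : CommRingCat.{0}} (p : Y ⟶ Spec R)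
    (M : (Spec R).Opens)
    (h : ∀ x ∈ M, ∃ a : R, x ∈ (PrimeSpectrum.basicOpen a : (Spec R).Opens) ∧
      (PrimeSpectrum.basicOpen a : (Spec R).Opens) ≤ M ∧
      ∃ s : Fin N → Γ(G, p ⁻¹ᵁ (PrimeSpectrum.basicOpen a)),
        ∀ (b : R) (hb : (PrimeSpectrum.basicOpen b : (Spec R).Opens) ≤ PrimeSpectrum.basicOpen a),
          IsBasisOn G (p.preimage_mono hb) s) :
    IsLocallyFreeOfRankOver p G M N := by
  intro x hx
  obtain ⟨a, hxa, haM, s, hs⟩ := h x hx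
  refine ⟨_, hxa, haM, s, fun V hVU => ?_⟩
  let ι : Type := {b : R // (PrimeSpectrum.basicOpen b : (Spec R).Opens) ≤ V}
  -- The overlap of two basic opens equals `basicOpen` of the product only propositionally, so the
  -- open set is kept as a variable.
  have hsW : ∀ b : R, ∀ W : (Spec R).Opens, W = PrimeSpectrum.basicOpen b →
      ∀ hW : W ≤ PrimeSpectrum.basicOpen a, IsBasisOn G (p.preimage_mono hW) s := by
    rintro b _ rfl hW
    exact hs b hW
  refine IsBasisOn.of_cover G (p.preimage_mono hVU) s
    (fun i : ι => p ⁻¹ᵁ (PrimeSpectrum.basicOpen i.1)) (fun i => p.preimage_mono i.2) ?_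
    (fun i => hs _ (i.2.trans hVU)) (fun i j => ?_)
  · intro y hy
    obtain ⟨_, ⟨_, ⟨b, rfl⟩, rfl⟩, hyb, hbV⟩ :=
      PrimeSpectrum.isBasis_basic_opens.exists_subset_of_mem_open hy V.2
    exact TopologicalSpace.Opens.mem_iSup.2 ⟨⟨b, hbV⟩, hyb⟩
  · exact hsW (i.1 * j.1) (PrimeSpectrum.basicOpen i.1 ⊓ PrimeSpectrum.basicOpen j.1)
      (PrimeSpectrum.basicOpen_mul _ _).symm ((inf_le_left.trans i.2).trans hVU)

/-- If `v` is linearly independent in `M` and spans `M` up to powers of `f`, then its image is a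
basis of the localization of `M` away from `f`. -/
theorem basis_of_isLocalizedModule_away {R A P Q ι : Type} [CommRing R] [CommRing A] [Algebra R A]
    [AddCommGroup P] [AddCommGroup Q] [Module R P] [Module R Q] [Module A Q] [IsScalarTower R A Q]
    (f : R) [IsLocalization.Away f A] (φ : P →ₗ[R] Q) [IsLocalizedModule.Away f φ] (v : ι → P)
    (hv : LinearIndependent R v)
    (hspan : ∀ x : P, ∃ k : ℕ, f ^ k • x ∈ Submodule.span R (Set.range v)) :
    LinearIndependent A (fun i => φ (v i)) ∧
      Submodule.span A (Set.range fun i => φ (v i)) = ⊤ := by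
  refine ⟨hv.of_isLocalizedModule A (Submonoid.powers f) φ, ?_⟩
  have hunit : ∀ k : ℕ, ∀ y : Q,
      f ^ k • y ∈ Submodule.span A (Set.range fun i => φ (v i)) →
        y ∈ Submodule.span A (Set.range fun i => φ (v i)) := by
    intro k y hy
    obtain ⟨u, hu⟩ := (IsLocalization.Away.algebraMap_isUnit (S := A) f).pow k
    have : y = (↑u⁻¹ : A) • f ^ k • y := by
      rw [← algebraMap_smul A (f ^ k) y, map_pow, ← hu, smul_smul, Units.inv_mul, one_smul]
    rw [this]
    exact Submodule.smul_mem _ _ hy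
  refine eq_top_iff.2 fun y _ => ?_
  obtain ⟨⟨x, s, k, rfl⟩, hx⟩ := IsLocalizedModule.surj (Submonoid.powers f) φ y
  apply hunit k
  have hx' : f ^ k • y = φ x := hx
  rw [hx']
  obtain ⟨j, hj⟩ := hspan x
  apply hunit j
  rw [← map_smul]
  have h : Submodule.span R (Set.range v) ≤
      ((Submodule.span A (Set.range fun i => φ (v i))).restrictScalars R).comap φ := by
    rw [Submodule.span_le]
    rintro _ ⟨i, rfl⟩
    exact Submodule.subset_span ⟨i, rfl⟩
  exact h hj

theorem isLocalization_away_of_eq_basicOpen {R : CommRingCat.{0}} {W : (Spec R).Opens} (f : R)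
    (hW : W = PrimeSpectrum.basicOpen f) : IsLocalization.Away f Γ(Spec R, W) := by
  subst hW
  exact StructureSheaf.IsLocalization.to_basicOpen R f

theorem isLocalizedModule_away_toOpen {R : CommRingCat.{0}} (P : ModuleCat.{0} R)
    {W : (Spec R).Opens} (f : R) (hW : W = PrimeSpectrum.basicOpen f) :
    IsLocalizedModule.Away f (tilde.toOpen P W).hom := by
  subst hW
  infer_instance

theorem isBasisOn_tilde {R : CommRingCat.{0}} (P : ModuleCat.{0} R) {U W : (Spec R).Opens} (f : R)
    (hW : W = PrimeSpectrum.basicOpen f) (hWU : W ≤ U) (v : Fin N → P)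
    (hv : LinearIndependent R v)
    (hspan : ∀ x : P, ∃ k : ℕ, f ^ k • x ∈ Submodule.span R (Set.range v)) :
    IsBasisOn (tilde P) hWU fun i => (tilde.toOpen P U).hom (v i) := by
  have := isLocalization_away_of_eq_basicOpen f hW
  let φ : P →ₗ[R] Γ(tilde P, W) := (tilde.toOpen P W).hom
  have : IsLocalizedModule.Away f φ := isLocalizedModule_away_toOpen P f hW
  exact basis_of_isLocalizedModule_away (A := Γ(Spec R, W)) f φ v hv hspan

/-- Localizing `Q` as an `R`-module at `f` is the same as localizing the ring `Q` at the image of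
`f`, whose basic open set is the preimage of that of `f`. -/
theorem isBasisOn_pushforward_unit {R Q : CommRingCat.{0}} (φ : R ⟶ Q)
    {U W : (Spec R).Opens} (f : R)
    (hW : W = PrimeSpectrum.basicOpen f) (hWU : W ≤ U) (v : Fin N → Q)
    (hv : letI := φ.hom.toAlgebra; LinearIndependent R v)
    (hspan : letI := φ.hom.toAlgebra
      ∀ x : Q, ∃ k : ℕ, f ^ k • x ∈ Submodule.span R (Set.range v)) :
    IsBasisOn ((Scheme.Modules.pushforward (Spec.map φ)).obj
      (SheafOfModules.unit (Spec Q).ringCatSheaf : (Spec Q).Modules)) hWU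
      fun i => (algebraMap Q Γ(Spec Q, Spec.map φ ⁻¹ᵁ U) (v i) :) := by
  have hloc := isLocalization_away_of_eq_basicOpen f hW
  have hW' : Spec.map φ ⁻¹ᵁ W = PrimeSpectrum.basicOpen (φ.hom f) := by rw [hW]; rfl
  have hloc' := isLocalization_away_of_eq_basicOpen (φ.hom f) hW'
  let := φ.hom.toAlgebra
  let : Algebra R Γ(Spec Q, Spec.map φ ⁻¹ᵁ W) :=
    ((algebraMap Q Γ(Spec Q, Spec.map φ ⁻¹ᵁ W)).comp φ.hom).toAlgebra
  let : Module Γ(Spec R, W) Γ(Spec Q, Spec.map φ ⁻¹ᵁ W) :=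
    Module.compHom _ ((Spec.map φ).app W).hom
  have : IsScalarTower R Γ(Spec R, W) Γ(Spec Q, Spec.map φ ⁻¹ᵁ W) := by
    refine IsScalarTower.of_algebraMap_smul fun r x => ?_
    change ((Spec.map φ).app W).hom (algebraMap R Γ(Spec R, W) r) * x =
      (algebraMap Q Γ(Spec Q, Spec.map φ ⁻¹ᵁ W)) (φ.hom r) * x
    congr 1
    -- The two ways in which `R` acts on sections over the preimage agree by naturality of
    -- `ΓSpecIso`.
    have h : (Scheme.ΓSpecIso R).inv ≫ (Spec R).presheaf.map (homOfLE (le_top : W ≤ ⊤)).op ≫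
        (Spec.map φ).app W = φ ≫ (Scheme.ΓSpecIso Q).inv ≫
          (Spec Q).presheaf.map (homOfLE (le_top : Spec.map φ ⁻¹ᵁ W ≤ ⊤)).op := by
      rw [Scheme.ΓSpecIso_inv_naturality_assoc, Scheme.Hom.naturality]
      rfl
    exact congrArg (fun F => F.hom r) h
  have : IsScalarTower R Q Γ(Spec Q, Spec.map φ ⁻¹ᵁ W) :=
    IsScalarTower.of_algebraMap_eq fun _ => rfl
  have : IsLocalizedModule.Away f
      (IsScalarTower.toAlgHom R Q Γ(Spec Q, Spec.map φ ⁻¹ᵁ W)).toLinearMap := by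
    refine isLocalizedModule_iff_isLocalization.2 ?_
    have h : Algebra.algebraMapSubmonoid Q (Submonoid.powers f) = Submonoid.powers (φ.hom f) :=
      Submonoid.map_powers _ _
    rw [h]
    exact hloc'
  exact basis_of_isLocalizedModule_away (A := Γ(Spec R, W))
    (Q := Γ(Spec Q, Spec.map φ ⁻¹ᵁ W)) f
    (IsScalarTower.toAlgHom R Q Γ(Spec Q, Spec.map φ ⁻¹ᵁ W)).toLinearMap v hv hspan

end Sheaf

end LandauGinzburg

namespace LandauGinzburg

/-! ### The twisted differential in coordinates. -/

section TopForms

open Set MvPolynomial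

variable (B : Type) [CommRing B] (n : ℕ)

/-- The map `(g_l) ↦ ∑ (g_l ∂_l f + z ∂_l g_l)`: the twisted differential on `Ω^{n-1}` in
coordinates. -/
def twistedDiv (z : B) (f : MvPolynomial (Fin n) B) :
    (Fin n → MvPolynomial (Fin n) B) →ₗ[B] MvPolynomial (Fin n) B where
  toFun g := ∑ l, (g l * pderiv l f + z • pderiv l (g l))
  map_add' g h := by
    rw [← Finset.sum_add_distrib]
    refine Finset.sum_congr rfl fun l _ => ?_
    simp only [Pi.add_apply, map_add, add_mul, smul_add]
    abel
  map_smul' b g := by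
    rw [RingHom.id_apply, Finset.smul_sum]
    refine Finset.sum_congr rfl fun l _ => ?_
    rw [Pi.smul_apply, Derivation.map_smul, smul_add, smul_mul_assoc, smul_comm]

theorem twistedDiv_apply (z : B) (f : MvPolynomial (Fin n) B)
    (g : Fin n → MvPolynomial (Fin n) B) :
    twistedDiv B n z f g = ∑ l, (g l * pderiv l f + z • pderiv l (g l)) := rfl

/-- Leaves a single basis vector in top degree, so that Ω^n is free of rank one. -/
instance : Subsingleton (powersetCard (Fin n) n) := by
  rw [← Fintype.card_le_one_iff_subsingleton, ← Nat.card_eq_fintype_card, powersetCard.card]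
  simp

theorem dxBasis_ofFinEmbEquiv (k : ℕ) (i : Fin k ↪o Fin n) :
    dxBasis B n k (powersetCard.ofFinEmbEquiv i) =
      exteriorPower.ιMulti _ k (KaehlerDifferential.mvPolynomialBasis B (Fin n) ∘ i) := by
  rw [dxBasis, exteriorPower.basis_apply, exteriorPower.ιMulti_family, Equiv.symm_apply_apply]

/-- Top forms are identified with functions by means of `dx₁ ∧ … ∧ dxₙ`. -/
def topFormEquiv : MvPolynomial (Fin n) B ≃ₗ[MvPolynomial (Fin n) B] Forms B n n :=
  ((dxBasis B n n).repr ≪≫ₗ Finsupp.uniqueLinearEquiv _ _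
    (powersetCard.ofFinEmbEquiv (RelEmbedding.refl _))).symm

theorem topFormEquiv_apply (p : MvPolynomial (Fin n) B) :
    topFormEquiv B n p =
      p • exteriorPower.ιMulti _ n (KaehlerDifferential.mvPolynomialBasis B (Fin n)) := by
  change (dxBasis B n n).repr.symm (Finsupp.single _ p) = _
  rw [Module.Basis.repr_symm_single, dxBasis_ofFinEmbEquiv]
  rfl

variable {B n}

theorem wedgeLeft_ιMulti (k : ℕ) (ω : Ω[MvPolynomial (Fin n) B⁄B])
    (v : Fin k → Ω[MvPolynomial (Fin n) B⁄B]) :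
    wedgeLeft B n k ω (exteriorPower.ιMulti _ k v) =
      exteriorPower.ιMulti _ (k + 1) (Matrix.vecCons ω v) := by
  apply Subtype.ext
  rw [exteriorPower.ιMulti_apply_coe, ExteriorAlgebra.ιMulti_succ_apply]
  rfl

/-- Left exterior multiplication is linear in the `1`-form. -/
theorem wedgeLeft_sum_smul (k : ℕ) {ι : Type} (s : Finset ι) (c : ι → MvPolynomial (Fin n) B)
    (ω : ι → Ω[MvPolynomial (Fin n) B⁄B]) (η : Forms B n k) :
    wedgeLeft B n k (∑ i ∈ s, c i • ω i) η = ∑ i ∈ s, c i • wedgeLeft B n k (ω i) η := by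
  apply Subtype.ext
  simp [wedgeLeft, Finset.sum_mul]

theorem D_eq_sum_pderiv (p : MvPolynomial (Fin n) B) :
    KaehlerDifferential.D B (MvPolynomial (Fin n) B) p =
      ∑ l, pderiv l p • KaehlerDifferential.mvPolynomialBasis B (Fin n) l := by
  conv_lhs => rw [← (KaehlerDifferential.mvPolynomialBasis B (Fin n)).sum_repr
    (KaehlerDifferential.D B (MvPolynomial (Fin n) B) p)]
  simp

variable {k : ℕ}

/-- The index set `{0, …, k} \ {l}`. -/
def omitIndex (l : Fin (k + 1)) : powersetCard (Fin (k + 1)) k :=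
  powersetCard.ofFinEmbEquiv (Fin.succAboveOrderEmb l)

theorem omitIndex_bijective : Function.Bijective (omitIndex (k := k)) := by
  rw [Fintype.bijective_iff_injective_and_card]
  constructor
  · intro l l' h
    have h2 := powersetCard.ofFinEmbEquiv.injective h
    exact Fin.succAbove_left_injective (congrArg (fun e : Fin k ↪o Fin (k + 1) => ⇑e) h2)
  · rw [← Nat.card_eq_fintype_card, ← Nat.card_eq_fintype_card, powersetCard.card]
    simp

/-- The sign of `dx_l ∧ dx_0 ∧ … ∧ dx_{l-1} ∧ dx_{l+1} ∧ … ∧ dx_k`. -/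
def omitSign (l : Fin (k + 1)) : ℤˣ := Equiv.Perm.sign (Fin.cycleRange l).symm

/-- In dp ∧ dx_I with I omitting l, every term other than ∂_l p dx_l repeats a factor; moving dx_l
into its place is a cycle, which accounts for the sign. -/
theorem wedgeLeft_D_omitIndex (p : MvPolynomial (Fin (k + 1)) B) (l : Fin (k + 1)) :
    wedgeLeft B (k + 1) k (KaehlerDifferential.D B _ p) (dxBasis B (k + 1) k (omitIndex l)) =
      topFormEquiv B (k + 1) (omitSign l • pderiv l p) := by
  rw [D_eq_sum_pderiv, wedgeLeft_sum_smul, Finset.sum_eq_single l, omitIndex,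
    dxBasis_ofFinEmbEquiv, wedgeLeft_ιMulti, topFormEquiv_apply]
  · have h : Matrix.vecCons (KaehlerDifferential.mvPolynomialBasis B (Fin (k + 1)) l)
        (KaehlerDifferential.mvPolynomialBasis B (Fin (k + 1)) ∘ (Fin.succAboveOrderEmb l)) =
        KaehlerDifferential.mvPolynomialBasis B (Fin (k + 1)) ∘ (Fin.cycleRange l).symm := by
      funext i
      refine Fin.cases ?_ (fun j => ?_) i
      · simp
      · simp
    rw [h, AlternatingMap.map_perm, smul_comm]
    rw [smul_assoc]
    rfl
  · intro j _ hj
    obtain ⟨i, hi⟩ := Fin.exists_succAbove_eq hj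
    rw [omitIndex, dxBasis_ofFinEmbEquiv, wedgeLeft_ιMulti,
      AlternatingMap.map_eq_zero_of_eq _ _ (i := 0) (j := i.succ) _ (Fin.succ_ne_zero i).symm,
      smul_zero]
    simp [hi]
  · simp

/-- Absorbing the signs into the coefficients of ω turns the differential into a signless
divergence. -/
theorem twistedDiff_apply_eq (z : B) (f : MvPolynomial (Fin (k + 1)) B)
    (ω : Forms B (k + 1) k) :
    twistedDiff B (k + 1) z f k ω = topFormEquiv B (k + 1) (twistedDiv B (k + 1) z f
      fun l => omitSign l • (dxBasis B (k + 1) k).repr ω (omitIndex l)) := by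
  have h1 : extDeriv B (k + 1) k ω = ∑ l, topFormEquiv B (k + 1)
      (omitSign l • pderiv l ((dxBasis B (k + 1) k).repr ω (omitIndex l))) := by
    simp only [← wedgeLeft_D_omitIndex]
    exact (omitIndex_bijective.sum_comp fun I => wedgeLeft B (k + 1) k
      (KaehlerDifferential.D B _ ((dxBasis B (k + 1) k).repr ω I)) (dxBasis B (k + 1) k I)).symm
  have h2 : wedgeLeft B (k + 1) k (KaehlerDifferential.D B _ f) ω =
      ∑ l, (dxBasis B (k + 1) k).repr ω (omitIndex l) •
        topFormEquiv B (k + 1) (omitSign l • pderiv l f) := by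
    simp only [← wedgeLeft_D_omitIndex]
    conv_lhs => rw [← (dxBasis B (k + 1) k).sum_repr ω, map_sum,
      ← omitIndex_bijective.sum_comp]
    simp only [map_smul]
  rw [twistedDiff, LinearMap.add_apply, LinearMap.smul_apply, LinearMap.restrictScalars_apply,
    h1, h2, twistedDiv_apply, Finset.sum_add_distrib, map_add, add_comm (z • _), ← map_sum]
  congr 1
  · rw [map_sum]
    refine Finset.sum_congr rfl fun l _ => ?_
    rw [← map_smul, smul_eq_mul, mul_smul_comm, smul_mul_assoc]
  · refine (((topFormEquiv B (k + 1)).restrictScalars B).map_smul z _).symm.trans ?_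
    rw [Finset.smul_sum, LinearEquiv.restrictScalars_apply]
    congr 1
    refine Finset.sum_congr rfl fun l _ => ?_
    rw [Units.smul_def, Units.smul_def, map_zsmul]

/-- Since the signs are invertible, the images agree. For n = 0 there are no forms of degree -1,
which matches the empty sum in `twistedDiv`. -/
theorem twistedExact_eq_map (z : B) (f : MvPolynomial (Fin n) B) :
    twistedExact B n z f n = (LinearMap.range (twistedDiv B n z f)).map
      ((topFormEquiv B n).restrictScalars B).toLinearMap := by
  cases n with
  | zero =>
    have h : twistedDiv B 0 z f = 0 := by
      ext g
      simp [twistedDiv_apply]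
    rw [h, LinearMap.range_zero, Submodule.map_bot, twistedExact]
  | succ k =>
    apply le_antisymm
    · rintro _ ⟨ω, rfl⟩
      exact ⟨_, ⟨_, rfl⟩, (twistedDiff_apply_eq z f ω).symm⟩
    · rintro _ ⟨_, ⟨g, rfl⟩, rfl⟩
      let e := Equiv.ofBijective _ (omitIndex_bijective (k := k))
      refine ⟨(dxBasis B (k + 1) k).equivFun.symm fun I => omitSign (e.symm I) • g (e.symm I), ?_⟩
      rw [twistedDiff_apply_eq]
      have h : (fun l => omitSign l • (dxBasis B (k + 1) k).repr
          ((dxBasis B (k + 1) k).equivFun.symm fun I => omitSign (e.symm I) • g (e.symm I))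
            (omitIndex l)) = g := by
        funext l
        rw [← Module.Basis.equivFun_apply, LinearEquiv.apply_symm_apply,
          show e.symm (omitIndex l) = l from e.symm_apply_apply l, smul_smul, Int.units_mul_self,
          one_smul]
      rw [h]
      rfl

variable (B n) in
/-- The top twisted de Rham cohomology in coordinates. -/
def twistedDeRhamEquiv (z : B) (f : MvPolynomial (Fin n) B) :
    (MvPolynomial (Fin n) B ⧸ LinearMap.range (twistedDiv B n z f)) ≃ₗ[B] TwistedDeRham B n z f :=
  Submodule.Quotient.equiv _ _ ((topFormEquiv B n).restrictScalars B)
    (twistedExact_eq_map z f).symm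

end TopForms

end LandauGinzburg

namespace LandauGinzburg

open MvPolynomial

/-! ### Homogeneous components and homogeneous ideals. -/

section Weights

variable {n : ℕ} {w : Fin n → ℤ}

theorem le_weight (hw : ∀ i, 0 < w i) (m : Fin n →₀ ℕ) (i : Fin n) :
    (m i : ℤ) ≤ Finsupp.weight w m := by
  rw [Finsupp.weight_apply, Finsupp.sum_fintype _ _ (by simp)]
  refine le_trans ?_ (Finset.single_le_sum (f := fun j => m j • w j)
    (fun j _ => nsmul_nonneg (hw j).le _) (Finset.mem_univ i))
  rw [nsmul_eq_mul]
  exact le_mul_of_one_le_right (by positivity) (hw i)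

theorem weight_nonneg (hw : ∀ i, 0 < w i) (m : Fin n →₀ ℕ) : 0 ≤ Finsupp.weight w m := by
  rw [Finsupp.weight_apply, Finsupp.sum_fintype _ _ (by simp)]
  exact Finset.sum_nonneg fun j _ => nsmul_nonneg (hw j).le _

theorem finite_weight_le (hw : ∀ i, 0 < w i) (d : ℤ) :
    {m : Fin n →₀ ℕ | Finsupp.weight w m ≤ d}.Finite := by
  refine (Set.finite_Iic (Finsupp.equivFunOnFinite.symm fun _ => d.toNat)).subset fun m hm i => ?_
  have h1 := le_weight hw m i
  have h2 : Finsupp.weight w m ≤ d := hm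
  simp only [Finsupp.equivFunOnFinite_symm_apply_apply]
  omega

variable {R : Type} [CommRing R]

/-- Integer-valued weights make the shift `d - e` harmless: components of negative degree vanish
when the weights are positive. -/
theorem weightedHomogeneousComponent_mul (p : MvPolynomial (Fin n) R) {h : MvPolynomial (Fin n) R}
    {e : ℤ} (hh : IsWeightedHomogeneous w h e) (d : ℤ) :
    weightedHomogeneousComponent w d (p * h) = weightedHomogeneousComponent w (d - e) p * h := by
  induction p using MvPolynomial.induction_on' with
  | monomial m a =>
    have h1 : IsWeightedHomogeneous w (monomial m a) (Finsupp.weight w m) :=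
      isWeightedHomogeneous_monomial _ _ _ rfl
    rw [weightedHomogeneousComponent_of_mem (h1.mul hh), weightedHomogeneousComponent_of_mem h1]
    by_cases hd : d = Finsupp.weight w m + e
    · rw [if_pos hd, if_pos (by omega)]
    · rw [if_neg hd, if_neg (by omega), zero_mul]
  | add p q hp hq => rw [add_mul, map_add, map_add, add_mul, hp, hq]

theorem weightedHomogeneousComponent_pderiv (p : MvPolynomial (Fin n) R) (i : Fin n) (d : ℤ) :
    weightedHomogeneousComponent w d (pderiv i p) =
      pderiv i (weightedHomogeneousComponent w (d + w i) p) := by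
  induction p using MvPolynomial.induction_on' with
  | monomial m a =>
    have h1 : IsWeightedHomogeneous w (monomial m a) (Finsupp.weight w m) :=
      isWeightedHomogeneous_monomial _ _ _ rfl
    have h2 : IsWeightedHomogeneous w (pderiv i (monomial m a)) (Finsupp.weight w m - w i) :=
      h1.pderiv (sub_add_cancel _ _)
    rw [weightedHomogeneousComponent_of_mem h1, weightedHomogeneousComponent_of_mem h2]
    by_cases hd : d + w i = Finsupp.weight w m
    · rw [if_pos hd, if_pos (by omega)]
    · rw [if_neg hd, if_neg (by omega), map_zero]
  | add p q hp hq => simp only [map_add, hp, hq]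

/-- An ideal is homogeneous if it contains the homogeneous components of its elements. -/
def IsHomog (w : Fin n → ℤ) (J : Ideal (MvPolynomial (Fin n) R)) : Prop :=
  ∀ p ∈ J, ∀ d, weightedHomogeneousComponent w d p ∈ J

theorem isHomog_bot : IsHomog w (⊥ : Ideal (MvPolynomial (Fin n) R)) := by
  intro p hp d
  rw [Ideal.mem_bot.1 hp, map_zero]
  exact zero_mem _

theorem IsHomog.sup_span {J : Ideal (MvPolynomial (Fin n) R)} (hJ : IsHomog w J)
    {h : MvPolynomial (Fin n) R} {e : ℤ} (hh : IsWeightedHomogeneous w h e) :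
    IsHomog w (J ⊔ Ideal.span {h}) := by
  intro p hp d
  obtain ⟨a, ha, b, hb, rfl⟩ := Submodule.mem_sup.1 hp
  obtain ⟨c, rfl⟩ := Ideal.mem_span_singleton'.1 hb
  rw [map_add, weightedHomogeneousComponent_mul c hh]
  exact Submodule.add_mem_sup (hJ a ha d) (Ideal.mul_mem_left _ _ (Ideal.mem_span_singleton_self _))

end Weights

/-! ### Regular sequences through ideals of initial segments. -/

section RegSeq

variable {A : Type} [CommRing A]

/-- The ideal generated by the first `k` terms of a sequence. -/
def prefixIdeal (r : ℕ → A) (k : ℕ) : Ideal A := Ideal.span (r '' Set.Iio k)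

theorem prefixIdeal_zero (r : ℕ → A) : prefixIdeal r 0 = ⊥ := by simp [prefixIdeal]

theorem prefixIdeal_succ (r : ℕ → A) (k : ℕ) :
    prefixIdeal r (k + 1) = prefixIdeal r k ⊔ Ideal.span {r k} := by
  have h : Set.Iio (k + 1) = insert k (Set.Iio k) := by ext; simp
  rw [prefixIdeal, prefixIdeal, h, Set.image_insert_eq, Ideal.span_insert, sup_comm]

/-- The first `n` terms of the sequence `r` are a weakly regular sequence. -/
def RegSeq (r : ℕ → A) (n : ℕ) : Prop :=
  ∀ k < n, ∀ x, x * r k ∈ prefixIdeal r k → x ∈ prefixIdeal r k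

/-- Extension of a finite family by zero. -/
def extendZero {Z : Type} [Zero Z] {n : ℕ} (r : Fin n → Z) (i : ℕ) : Z :=
  if h : i < n then r ⟨i, h⟩ else 0

theorem extendZero_of_lt {Z : Type} [Zero Z] {n : ℕ} (r : Fin n → Z) {i : ℕ} (h : i < n) :
    extendZero r i = r ⟨i, h⟩ := dif_pos h

theorem prefixIdeal_extendZero {n : ℕ} (r : Fin n → A) :
    prefixIdeal (extendZero r) n = Ideal.span (Set.range r) := by
  rw [prefixIdeal]
  congr 1
  ext x
  constructor
  · rintro ⟨i, hi, rfl⟩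
    exact ⟨⟨i, hi⟩, (extendZero_of_lt r hi).symm⟩
  · rintro ⟨i, rfl⟩
    exact ⟨i, i.2, extendZero_of_lt r i.2⟩

/-- Indexing by ℕ, with zeros past the end, lets later inductions run over the length of the
sequence. -/
theorem isWeaklyRegular_ofFn_iff {n : ℕ} (r : Fin n → A) :
    RingTheory.Sequence.IsWeaklyRegular A (List.ofFn r) ↔ RegSeq (extendZero r) n := by
  have key : ∀ k < n, Ideal.ofList ((List.ofFn r).take k) • (⊤ : Submodule A A) =
      prefixIdeal (extendZero r) k := by
    intro k hk
    rw [smul_eq_mul, Ideal.mul_top, Ideal.ofList, prefixIdeal]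
    congr 1
    ext x
    simp only [Set.mem_ofPred_eq, List.mem_take_iff_getElem, List.length_ofFn, List.getElem_ofFn,
      Set.mem_image, Set.mem_Iio]
    constructor
    · rintro ⟨i, hi, rfl⟩
      exact ⟨i, by omega, extendZero_of_lt r (by omega)⟩
    · rintro ⟨i, hi, rfl⟩
      exact ⟨i, by omega, (extendZero_of_lt r (by omega)).symm⟩
  rw [RingTheory.Sequence.isWeaklyRegular_iff]
  simp only [List.length_ofFn, List.getElem_ofFn]
  refine forall₂_congr fun k hk => ?_
  rw [isSMulRegular_quotient_iff_mem_of_smul_mem, key k hk, extendZero_of_lt r hk]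
  simp only [smul_eq_mul, mul_comm]

end RegSeq

/-! ### Hilbert functions of graded quotients. -/

section Hilbert

variable {n : ℕ} {w : Fin n → ℤ} {K : Type} [Field K]

theorem finite_weightedHomogeneousSubmodule (hw : ∀ i, 0 < w i) (d : ℤ) :
    Module.Finite K (weightedHomogeneousSubmodule K w d) := by
  rw [Module.Finite.iff_fg]
  have hfin : {m : Fin n →₀ ℕ | Finsupp.weight w m = d}.Finite :=
    (finite_weight_le hw d).subset fun m hm => (show Finsupp.weight w m = d from hm).le
  refine ⟨(hfin.image fun m => monomial m (1 : K)).toFinset, ?_⟩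
  rw [Set.Finite.coe_toFinset]
  apply le_antisymm
  · rw [Submodule.span_le]
    rintro _ ⟨m, hm, rfl⟩
    exact isWeightedHomogeneous_monomial _ _ _ hm
  · intro p hp
    rw [p.as_sum]
    refine Submodule.sum_mem _ fun m hm => ?_
    rw [← mul_one (coeff m p), ← smul_eq_mul, ← smul_monomial]
    exact Submodule.smul_mem _ _ (Submodule.subset_span ⟨m, hp (mem_support_iff.1 hm), rfl⟩)

/-- The image of the homogeneous polynomials of degree `d` in the quotient by `J`. -/
def gradedPiece (w : Fin n → ℤ) (J : Ideal (MvPolynomial (Fin n) K)) (d : ℤ) :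
    Submodule K (MvPolynomial (Fin n) K ⧸ J) :=
  (weightedHomogeneousSubmodule K w d).map (Ideal.Quotient.mkₐ K J).toLinearMap

/-- The Hilbert function. -/
def hilb (w : Fin n → ℤ) (J : Ideal (MvPolynomial (Fin n) K)) (d : ℤ) : ℕ :=
  Module.finrank K (gradedPiece w J d)

theorem finite_gradedPiece (hw : ∀ i, 0 < w i) (J : Ideal (MvPolynomial (Fin n) K)) (d : ℤ) :
    Module.Finite K (gradedPiece w J d) := by
  have := finite_weightedHomogeneousSubmodule (K := K) hw d
  exact Module.Finite.map _ _

theorem hilb_of_neg (hw : ∀ i, 0 < w i) (J : Ideal (MvPolynomial (Fin n) K)) {d : ℤ}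
    (hd : d < 0) : hilb w J d = 0 := by
  have h : weightedHomogeneousSubmodule K w d = ⊥ := by
    refine eq_bot_iff.2 fun p hp => ?_
    rw [Submodule.mem_bot]
    ext m
    by_contra hm
    have := weight_nonneg hw m
    have h2 : Finsupp.weight w m = d := hp hm
    omega
  rw [hilb, gradedPiece, h, Submodule.map_bot, finrank_bot]

/-- Multiplication by (the class of) `h` on the quotient by `J`. -/
def mulQuot (J : Ideal (MvPolynomial (Fin n) K)) (h : MvPolynomial (Fin n) K) :
    (MvPolynomial (Fin n) K ⧸ J) →ₗ[K] (MvPolynomial (Fin n) K ⧸ J) :=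
  LinearMap.mulLeft K (Ideal.Quotient.mk J h)

/-- Rank-nullity for the projection from R/J to R/(J + h) in degree d. As J and h are homogeneous,
its kernel is h times the piece of degree d - e. -/
theorem hilb_eq_add (hw : ∀ i, 0 < w i) {J : Ideal (MvPolynomial (Fin n) K)} (hJ : IsHomog w J)
    {h : MvPolynomial (Fin n) K} {e : ℤ} (hh : IsWeightedHomogeneous w h e) (d : ℤ) :
    hilb w J d = hilb w (J ⊔ Ideal.span {h}) d +
      Module.finrank K ((gradedPiece w J (d - e)).map (mulQuot J h)) := by
  have := finite_gradedPiece hw J d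
  let q : (MvPolynomial (Fin n) K ⧸ J) →ₗ[K] (MvPolynomial (Fin n) K ⧸ J ⊔ Ideal.span {h}) :=
    (Ideal.Quotient.factorₐ K (le_sup_left : J ≤ J ⊔ Ideal.span {h})).toLinearMap
  have h1 := (q.domRestrict (gradedPiece w J d)).finrank_range_add_finrank_ker
  have h2 : LinearMap.range (q.domRestrict (gradedPiece w J d)) =
      gradedPiece w (J ⊔ Ideal.span {h}) d := by
    rw [LinearMap.range_domRestrict, gradedPiece, gradedPiece, ← Submodule.map_comp]
    rfl
  have h3 : (LinearMap.ker (q.domRestrict (gradedPiece w J d))).map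
      (gradedPiece w J d).subtype = (gradedPiece w J (d - e)).map (mulQuot J h) := by
    ext x
    constructor
    · rintro ⟨⟨_, p, hp, rfl⟩, hx, rfl⟩
      have hx' : p ∈ J ⊔ Ideal.span {h} := Ideal.Quotient.eq_zero_iff_mem.1 hx
      obtain ⟨a, ha, b, hb, rfl⟩ := Submodule.mem_sup.1 hx'
      obtain ⟨c, rfl⟩ := Ideal.mem_span_singleton'.1 hb
      refine ⟨_, ⟨weightedHomogeneousComponent w (d - e) c,
        weightedHomogeneousComponent_isWeightedHomogeneous _ _, rfl⟩, ?_⟩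
      have h4 := hp.weightedHomogeneousComponent_same
      rw [map_add, weightedHomogeneousComponent_mul c hh] at h4
      change Ideal.Quotient.mk J h * Ideal.Quotient.mk J _ = Ideal.Quotient.mk J (a + c * h)
      rw [← map_mul, Ideal.Quotient.mk_eq_mk_iff_sub_mem, ← h4, mul_comm h]
      rw [sub_add_cancel_right]
      exact J.neg_mem (hJ a ha d)
    · rintro ⟨_, ⟨p, hp, rfl⟩, rfl⟩
      refine ⟨⟨_, p * h, ?_, rfl⟩, ?_, ?_⟩
      · have := IsWeightedHomogeneous.mul hp hh
        rwa [sub_add_cancel] at this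
      · exact Ideal.Quotient.eq_zero_iff_mem.2
          (Ideal.mul_mem_left _ _ (le_sup_right (a := J) (Ideal.mem_span_singleton_self h)))
      · change Ideal.Quotient.mk J (p * h) = Ideal.Quotient.mk J h * Ideal.Quotient.mk J p
        rw [← map_mul, mul_comm]
  rw [← h3, Submodule.finrank_map_subtype_eq, hilb, hilb, ← h2, h1]

theorem hilb_le_add (hw : ∀ i, 0 < w i) {J : Ideal (MvPolynomial (Fin n) K)} (hJ : IsHomog w J)
    {h : MvPolynomial (Fin n) K} {e : ℤ} (hh : IsWeightedHomogeneous w h e) (d : ℤ) :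
    hilb w J d ≤ hilb w (J ⊔ Ideal.span {h}) d + hilb w J (d - e) := by
  have := finite_gradedPiece hw J (d - e)
  rw [hilb_eq_add hw hJ hh]
  exact Nat.add_le_add_left (Submodule.finrank_map_le _ _) _

/-- By `hilb_eq_add`, the equality says that multiplication by h preserves the dimension of each
graded piece, that is, is injective on it. Homogeneity of J reduces an arbitrary element to its
components. -/
theorem regular_iff_hilb (hw : ∀ i, 0 < w i) {J : Ideal (MvPolynomial (Fin n) K)}
    (hJ : IsHomog w J) {h : MvPolynomial (Fin n) K} {e : ℤ} (hh : IsWeightedHomogeneous w h e) :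
    (∀ x, x * h ∈ J → x ∈ J) ↔
      ∀ d, hilb w J d = hilb w (J ⊔ Ideal.span {h}) d + hilb w J (d - e) := by
  constructor
  · intro hreg d
    rw [hilb_eq_add hw hJ hh, hilb]
    congr 1
    have hinj : Function.Injective (mulQuot J h) := by
      rw [← LinearMap.ker_eq_bot, LinearMap.ker_eq_bot']
      intro x
      obtain ⟨x, rfl⟩ := Ideal.Quotient.mk_surjective x
      intro hx
      change Ideal.Quotient.mk J h * Ideal.Quotient.mk J x = 0 at hx
      rw [← map_mul, Ideal.Quotient.eq_zero_iff_mem, mul_comm] at hx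
      exact Ideal.Quotient.eq_zero_iff_mem.2 (hreg x hx)
    exact (Submodule.equivMapOfInjective _ hinj _).finrank_eq.symm
  · intro heq x hx
    have hcomp : ∀ d, weightedHomogeneousComponent w d x ∈ J := by
      intro d
      have h1 := heq (d + e)
      rw [hilb_eq_add hw hJ hh, add_right_inj, add_sub_cancel_right, hilb] at h1
      have := finite_gradedPiece hw J d
      have h2 := ((mulQuot J h).domRestrict (gradedPiece w J d)).finrank_range_add_finrank_ker
      rw [LinearMap.range_domRestrict, h1, Nat.add_eq_left, Submodule.finrank_eq_zero,
        LinearMap.ker_eq_bot'] at h2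
      have h3 := h2 ⟨Ideal.Quotient.mk J (weightedHomogeneousComponent w d x),
        _, weightedHomogeneousComponent_isWeightedHomogeneous _ _, rfl⟩ (by
          change Ideal.Quotient.mk J h * Ideal.Quotient.mk J _ = 0
          rw [← map_mul, Ideal.Quotient.eq_zero_iff_mem, mul_comm]
          have h4 := hJ _ hx (d + e)
          rwa [weightedHomogeneousComponent_mul x hh, add_sub_cancel_right] at h4)
      exact Ideal.Quotient.eq_zero_iff_mem.1 (congrArg Subtype.val h3)
    rw [← finsum_weightedHomogeneousComponent w x]
    exact finsum_induction (· ∈ J) J.zero_mem (fun _ _ => J.add_mem) fun d => hcomp d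

end Hilbert

end LandauGinzburg

namespace LandauGinzburg

open MvPolynomial

/-! ### Hilbert series and a numerical criterion for regularity. -/

section HilbertSeries

variable {n : ℕ} {w : Fin n → ℤ} {K : Type} [Field K]

/-- The Hilbert series. -/
def hilbSeries (w : Fin n → ℤ) (J : Ideal (MvPolynomial (Fin n) K)) : PowerSeries ℤ :=
  PowerSeries.mk fun d => (hilb w J d : ℤ)

/-- When J and h are homogeneous, h of degree e, this coefficient is the dimension of the kernel of
h on the piece of degree d - e: the defect of regularity. -/
theorem coeff_hilbSeries_sup_sub (hw : ∀ i, 0 < w i) (J : Ideal (MvPolynomial (Fin n) K))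
    (h : MvPolynomial (Fin n) K) (e d : ℕ) :
    PowerSeries.coeff d (hilbSeries w (J ⊔ Ideal.span {h}) - hilbSeries w J *
        (1 - PowerSeries.X ^ e)) =
      (hilb w (J ⊔ Ideal.span {h}) d + hilb w J (d - e) - hilb w J d : ℤ) := by
  rw [mul_sub, mul_one, map_sub, map_sub, PowerSeries.coeff_mul_X_pow', hilbSeries, hilbSeries,
    PowerSeries.coeff_mk, PowerSeries.coeff_mk]
  split_ifs with hed
  · rw [PowerSeries.coeff_mk, Nat.cast_sub hed]
    ring
  · rw [hilb_of_neg hw J (d := (d : ℤ) - e) (by omega)]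
    simp

theorem isHomog_prefixIdeal {r : ℕ → MvPolynomial (Fin n) K} {e : ℕ → ℕ} {m : ℕ}
    (hr : ∀ k < m, IsWeightedHomogeneous w (r k) (e k : ℤ)) :
    ∀ k ≤ m, IsHomog w (prefixIdeal r k) := by
  intro k
  induction k with
  | zero =>
    intro _
    rw [prefixIdeal_zero]
    exact isHomog_bot
  | succ k ih =>
    intro hk
    rw [prefixIdeal_succ]
    exact (ih (by omega)).sup_span (hr k (by omega))

theorem hilbSeries_of_regSeq (hw : ∀ i, 0 < w i) {r : ℕ → MvPolynomial (Fin n) K} {e : ℕ → ℕ}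
    {m : ℕ} (hr : ∀ k < m, IsWeightedHomogeneous w (r k) (e k : ℤ)) (hreg : RegSeq r m) :
    hilbSeries w (prefixIdeal r m) =
      hilbSeries w (⊥ : Ideal (MvPolynomial (Fin n) K)) *
          ∏ k ∈ Finset.range m, (1 - PowerSeries.X ^ e k) := by
  suffices h : ∀ k ≤ m, hilbSeries w (prefixIdeal r k) =
      hilbSeries w (⊥ : Ideal (MvPolynomial (Fin n) K)) *
          ∏ k ∈ Finset.range k, (1 - PowerSeries.X ^ e k) from
    h m le_rfl
  intro k
  induction k with
  | zero =>
    intro _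
    simp [prefixIdeal_zero]
  | succ k ih =>
    intro hk
    rw [Finset.prod_range_succ, ← mul_assoc, ← ih (by omega), ← sub_eq_zero]
    ext d
    rw [prefixIdeal_succ, coeff_hilbSeries_sup_sub hw,
      (regular_iff_hilb hw (isHomog_prefixIdeal hr k (by omega)) (hr k (by omega))).1
        (hreg k (by omega)) d]
    simp

/-- A sum of products of series by units with constant term one controls its lowest terms. -/
theorem eq_zero_of_sum_mul_nonpos {m : ℕ} (D P : ℕ → PowerSeries ℤ)
    (hD : ∀ k < m, ∀ d, 0 ≤ PowerSeries.coeff d (D k))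
    (hP : ∀ k < m, PowerSeries.constantCoeff (P k) = 1)
    (hsum : ∀ d, PowerSeries.coeff d (∑ k ∈ Finset.range m, D k * P k) ≤ 0) :
    ∀ k < m, D k = 0 := by
  suffices h : ∀ d, ∀ k < m, PowerSeries.coeff d (D k) = 0 from
    fun k hk => PowerSeries.ext fun d => by rw [h d k hk, map_zero]
  intro d
  induction d using Nat.strong_induction_on with
  | _ d ih =>
    -- The lower coefficients of `D k` vanish by induction, so only the constant term 1 of `P k`
    -- contributes. A sum of non-negative terms that is at most zero then vanishes termwise.
    have h1 : ∀ k ∈ Finset.range m,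
        PowerSeries.coeff d (D k * P k) = PowerSeries.coeff d (D k) := by
      intro k hk
      rw [Finset.mem_range] at hk
      rw [PowerSeries.coeff_mul, Finset.sum_eq_single (d, 0)]
      · simp [hP k hk]
      · rintro ⟨a, b⟩ hab hne
        rw [Finset.HasAntidiagonal.mem_antidiagonal] at hab
        have hlt : a < d := by
          rcases Nat.lt_or_ge a d with h | h
          · exact h
          · exact absurd (Prod.ext (by dsimp at hab ⊢; omega) (by dsimp at hab ⊢; omega)) hne
        simp [ih a hlt k hk]
      · intro h
        simp at h
    have h2 := hsum d
    rw [map_sum, Finset.sum_congr rfl h1] at h2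
    have h3 : ∀ k ∈ Finset.range m, 0 ≤ PowerSeries.coeff d (D k) :=
      fun k hk => hD k (Finset.mem_range.1 hk) d
    have h4 := (Finset.sum_eq_zero_iff_of_nonneg h3).1 (le_antisymm h2 (Finset.sum_nonneg h3))
    exact fun k hk => h4 k (Finset.mem_range.2 hk)

/-- Writes the gap between actual and expected Hilbert series as a combination of the one-step
defects, the form that `eq_zero_of_sum_mul_nonpos` requires. -/
theorem telescope_mul {A : Type} [CommRing A] (H : ℕ → A) (u : ℕ → A) (m : ℕ) :
    H m - H 0 * ∏ k ∈ Finset.range m, u k =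
      ∑ k ∈ Finset.range m, (H (k + 1) - H k * u k) * ∏ j ∈ Finset.Ico (k + 1) m, u j := by
  induction m with
  | zero => simp
  | succ m ih =>
    rw [Finset.sum_range_succ, Finset.Ico_self, Finset.prod_empty, mul_one,
      Finset.prod_range_succ]
    have h : ∀ k ∈ Finset.range m, (H (k + 1) - H k * u k) * ∏ j ∈ Finset.Ico (k + 1) (m + 1), u j =
        (H (k + 1) - H k * u k) * (∏ j ∈ Finset.Ico (k + 1) m, u j) * u m := by
      intro k hk
      rw [Finset.mem_range] at hk
      rw [Finset.prod_Ico_succ_top (by omega), mul_assoc]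
    rw [Finset.sum_congr rfl h, ← Finset.sum_mul, ← ih]
    ring

/-- A sequence of homogeneous elements of positive degrees is weakly regular as soon as the Hilbert
series of the quotient is at most the expected one. -/
theorem regSeq_of_hilbSeries_le (hw : ∀ i, 0 < w i) {r : ℕ → MvPolynomial (Fin n) K} {e : ℕ → ℕ}
    {m : ℕ} (hr : ∀ k < m, IsWeightedHomogeneous w (r k) (e k : ℤ)) (he : ∀ k < m, 0 < e k)
    (hle : ∀ d, PowerSeries.coeff d (hilbSeries w (prefixIdeal r m)) ≤ PowerSeries.coeff d
      (hilbSeries w (⊥ : Ideal (MvPolynomial (Fin n) K)) *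
        ∏ k ∈ Finset.range m, (1 - PowerSeries.X ^ e k))) :
    RegSeq r m := by
  have h0 := eq_zero_of_sum_mul_nonpos (m := m)
    (fun k => hilbSeries w (prefixIdeal r (k + 1)) -
      hilbSeries w (prefixIdeal r k) * (1 - PowerSeries.X ^ e k))
    (fun k => ∏ j ∈ Finset.Ico (k + 1) m, (1 - PowerSeries.X ^ e j)) ?_ ?_ ?_
  · intro k hk
    refine (regular_iff_hilb hw (isHomog_prefixIdeal hr k hk.le) (hr k hk)).2 fun d => ?_
    rcases lt_or_ge d 0 with hd | hd
    · rw [hilb_of_neg hw _ hd, hilb_of_neg hw _ hd, hilb_of_neg hw _ (d := d - e k) (by omega)]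
    · lift d to ℕ using hd
      have h1 := congrArg (PowerSeries.coeff d) (h0 k hk)
      rw [prefixIdeal_succ, coeff_hilbSeries_sup_sub hw, map_zero] at h1
      omega
  · intro k hk d
    rw [prefixIdeal_succ, coeff_hilbSeries_sup_sub hw]
    have := hilb_le_add hw (isHomog_prefixIdeal hr k hk.le) (hr k hk) d
    omega
  · intro k hk
    rw [map_prod]
    refine Finset.prod_eq_one fun j hj => ?_
    have := he j (Finset.mem_Ico.1 hj).2
    simp [this.ne']
  · intro d
    rw [← telescope_mul (fun k => hilbSeries w (prefixIdeal r k)), map_sub, prefixIdeal_zero]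
    exact sub_nonpos.2 (hle d)

/-- The Hilbert series of the polynomial ring. -/
theorem hilbSeries_bot_mul (v : Fin n → ℕ) (hv : ∀ i, 0 < v i) (hwv : ∀ i, w i = v i) :
    hilbSeries w (⊥ : Ideal (MvPolynomial (Fin n) K)) * ∏ i, (1 - PowerSeries.X ^ v i) = 1 := by
  have hw : ∀ i, 0 < w i := fun i => by rw [hwv]; exact_mod_cast hv i
  -- The variables form a regular sequence whose quotient is `K`, with Hilbert series 1;
  -- `hilbSeries_of_regSeq` then gives the formula.
  let x : ℕ → MvPolynomial (Fin n) K := extendZero fun i => X i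
  have hmem : ∀ k ≤ n, ∀ p, p ∈ prefixIdeal x k ↔
      ∀ m ∈ p.support, ∃ i : Fin n, i.1 < k ∧ m i ≠ 0 := by
    intro k hk p
    have h1 : prefixIdeal x k = Ideal.span (X '' {i : Fin n | i.1 < k}) := by
      rw [prefixIdeal]
      congr 1
      ext y
      constructor
      · rintro ⟨i, hi, rfl⟩
        have hi' : i < k := hi
        exact ⟨⟨i, by omega⟩, hi, (extendZero_of_lt _ _).symm⟩
      · rintro ⟨i, hi, rfl⟩
        exact ⟨i, hi, extendZero_of_lt _ _⟩
    rw [h1, mem_ideal_span_X_image]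
    rfl
  have hreg : RegSeq x n := by
    intro k hk p hp
    rw [hmem k hk.le] at hp ⊢
    intro m hm
    have hxk : x k = X ⟨k, hk⟩ := extendZero_of_lt _ _
    have h1 : m + Finsupp.single ⟨k, hk⟩ 1 ∈ (p * x k).support := by
      rw [mem_support_iff, hxk, coeff_mul_X]
      exact mem_support_iff.1 hm
    obtain ⟨i, hi, hmi⟩ := hp _ h1
    refine ⟨i, hi, ?_⟩
    have hne : (⟨k, hk⟩ : Fin n) ≠ i := fun h => by rw [← h] at hi; exact lt_irrefl _ hi
    simpa [Finsupp.single_eq_of_ne hne.symm] using hmi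
  have hhom : ∀ k < n, IsWeightedHomogeneous w (x k)
      ((extendZero (fun i => (v i : ℕ)) k : ℕ) : ℤ) := by
    intro k hk
    rw [show x k = X ⟨k, hk⟩ from extendZero_of_lt _ _, extendZero_of_lt _ hk, ← hwv]
    exact isWeightedHomogeneous_X _ _ _
  have h1 := hilbSeries_of_regSeq hw hhom hreg
  rw [Finset.prod_range] at h1
  simp only [extendZero_of_lt _ (Fin.is_lt _), Fin.eta] at h1
  rw [← h1]
  have hnot : ∀ m : Fin n →₀ ℕ, Finsupp.weight w m = 0 → m = 0 := by
    intro m hm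
    ext i
    have := le_weight hw m i
    simp only [Finsupp.coe_zero, Pi.zero_apply]
    omega
  ext d
  rw [hilbSeries, PowerSeries.coeff_mk, PowerSeries.coeff_one, hilb]
  split_ifs with hd
  · subst hd
    have hspan : gradedPiece w (prefixIdeal x n) ((0 : ℕ) : ℤ) = Submodule.span K {1} := by
      apply le_antisymm
      · rintro _ ⟨p, hp, rfl⟩
        have hp' : p = C (coeff 0 p) := by
          ext m
          rw [coeff_C]
          split_ifs with hm
          · rw [hm]
          · by_contra hne
            exact hm (hnot m (hp hne)).symm
        rw [hp', ← mul_one (C (coeff 0 p)), ← smul_eq_C_mul, map_smul]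
        exact Submodule.smul_mem _ _ (Submodule.mem_span_singleton_self _)
      · rw [Submodule.span_singleton_le_iff_mem]
        exact ⟨1, isWeightedHomogeneous_one _ _, rfl⟩
    rw [hspan, finrank_span_singleton]
    · rfl
    · intro h
      have h2 : (1 : MvPolynomial (Fin n) K) ∈ prefixIdeal x n :=
        Ideal.Quotient.eq_zero_iff_mem.1 h
      rw [hmem n le_rfl] at h2
      obtain ⟨i, _, hi⟩ := h2 0 (by simp)
      exact hi rfl
  · have hbot : gradedPiece w (prefixIdeal x n) (d : ℤ) = ⊥ := by
      rw [eq_bot_iff]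
      rintro _ ⟨p, hp, rfl⟩
      refine Ideal.Quotient.eq_zero_iff_mem.2 ((hmem n le_rfl p).2 fun m hm => ?_)
      by_contra! h
      have h3 : m = 0 := Finsupp.ext fun i => h i i.2
      have h4 := hp (mem_support_iff.1 hm)
      rw [h3, map_zero] at h4
      exact hd (by exact_mod_cast h4.symm)
    rw [hbot, finrank_bot, Nat.cast_zero]

end HilbertSeries

end LandauGinzburg

namespace LandauGinzburg

/-! ### Evaluating the Hilbert series at 1. -/

section SeriesQuotient

/-- The polynomial `1 + X + … + X^(m-1)`. -/
def geomPoly (m : ℕ) : Polynomial ℤ := ∑ j ∈ Finset.range m, Polynomial.X ^ j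

theorem one_sub_X_mul_geomPoly (m : ℕ) :
    (1 - PowerSeries.X) * (geomPoly m : PowerSeries ℤ) = 1 - PowerSeries.X ^ m := by
  rw [← mul_neg_geom_sum, geomPoly]
  congr 1
  rw [← Polynomial.coeToPowerSeries.ringHom_apply, map_sum]
  simp

theorem coeff_geomPoly_nonneg (m d : ℕ) : 0 ≤ (geomPoly m).coeff d := by
  rw [geomPoly, Polynomial.finsetSum_coeff]
  refine Finset.sum_nonneg fun j _ => ?_
  rw [Polynomial.coeff_X_pow]
  split_ifs <;> simp

/-- A quotient of products `∏ (1 - X^e) / ∏ (1 - X^v)` with non-negative coefficients and as many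
factors in the numerator as in the denominator is a polynomial with value `∏ e / ∏ v` at `1`. -/
theorem sum_coeff_mul_prod {n : ℕ} (P : PowerSeries ℤ) (v e : Fin n → ℕ) (hv : ∀ i, 0 < v i)
    (hP : ∀ d, 0 ≤ PowerSeries.coeff d P)
    (h : P * ∏ i, (1 - PowerSeries.X ^ v i) = ∏ i, (1 - PowerSeries.X ^ e i)) :
    ∃ D, (∀ d ≥ D, PowerSeries.coeff d P = 0) ∧
      (∑ d ∈ Finset.range D, PowerSeries.coeff d P) * ∏ i, (v i : ℤ) = ∏ i, (e i : ℤ) := by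
  let Q := ∏ i, geomPoly (v i)
  let E := ∏ i, geomPoly (e i)
  have hcoe : ∀ u : Fin n → ℕ, ((∏ i, geomPoly (u i) : Polynomial ℤ) : PowerSeries ℤ) =
      ∏ i, (geomPoly (u i) : PowerSeries ℤ) := fun u => by
    rw [← Polynomial.coeToPowerSeries.ringHom_apply, map_prod]
    rfl
  -- Both products have n factors, so the same power (1 - X)^n cancels on the two sides.
  have hPQ : P * (Q : PowerSeries ℤ) = (E : PowerSeries ℤ) := by
    have hne : (1 - PowerSeries.X : PowerSeries ℤ) ^ n ≠ 0 := by
      apply pow_ne_zero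
      intro h0
      have := congrArg (PowerSeries.coeff 0) h0
      simp at this
    apply mul_left_cancel₀ hne
    have hp : ∀ u : Fin n → ℕ, (1 - PowerSeries.X : PowerSeries ℤ) ^ n *
        ∏ i, (geomPoly (u i) : PowerSeries ℤ) = ∏ i, (1 - PowerSeries.X ^ u i) := fun u => by
      simp only [← one_sub_X_mul_geomPoly, Finset.prod_mul_distrib, Finset.prod_const,
        Finset.card_univ, Fintype.card_fin]
    rw [hcoe, hcoe, mul_left_comm, hp, hp, h]
  have hQ0 : Q.coeff 0 = 1 := by
    rw [Polynomial.coeff_zero_eq_eval_zero, Polynomial.eval_prod]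
    refine Finset.prod_eq_one fun i _ => ?_
    rw [← Polynomial.coeff_zero_eq_eval_zero, geomPoly, Polynomial.finsetSum_coeff,
      Finset.sum_eq_single_of_mem 0 (Finset.mem_range.2 (hv i))]
    · simp
    · intro j _ hj
      rw [Polynomial.coeff_X_pow, if_neg hj.symm]
  have hQ : ∀ d, 0 ≤ Q.coeff d := by
    refine Finset.prod_induction _ (fun p : Polynomial ℤ => ∀ d, 0 ≤ p.coeff d) ?_ ?_ ?_
    · intro p q hp hq d
      rw [Polynomial.coeff_mul]
      exact Finset.sum_nonneg fun x _ => mul_nonneg (hp _) (hq _)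
    · intro d
      rw [Polynomial.coeff_one]
      split_ifs <;> simp
    · exact fun i _ => coeff_geomPoly_nonneg _
  -- `Q` has constant term 1 and non-negative coefficients, so `P` is bounded by the polynomial `E`
  -- and is itself a polynomial.
  have hle : ∀ d, PowerSeries.coeff d P ≤ E.coeff d := by
    intro d
    rw [← Polynomial.coeff_coe, ← hPQ, PowerSeries.coeff_mul]
    refine le_trans (le_of_eq ?_) (Finset.single_le_sum
      (f := fun x : ℕ × ℕ => PowerSeries.coeff x.1 P * PowerSeries.coeff x.2 (Q : PowerSeries ℤ))
      (fun x _ => mul_nonneg (hP _) ?_)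
      (show (d, 0) ∈ _ from Finset.HasAntidiagonal.mem_antidiagonal.2 (add_zero d)))
    · rw [Polynomial.coeff_coe, hQ0, mul_one]
    · rw [Polynomial.coeff_coe]
      exact hQ _
  have hzero : ∀ d ≥ E.natDegree + 1, PowerSeries.coeff d P = 0 := fun d hd =>
    le_antisymm ((hle d).trans_eq (Polynomial.coeff_eq_zero_of_natDegree_lt (by omega))) (hP d)
  refine ⟨E.natDegree + 1, hzero, ?_⟩
  have hPp : ((PowerSeries.trunc (E.natDegree + 1) P : Polynomial ℤ) : PowerSeries ℤ) = P := by
    ext d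
    rw [Polynomial.coeff_coe, PowerSeries.coeff_trunc]
    split_ifs with hd
    · rfl
    · exact (hzero d (by omega)).symm
  have hpoly : PowerSeries.trunc (E.natDegree + 1) P * Q = E := by
    apply Polynomial.coe_injective
    rw [Polynomial.coe_mul, hPp, hPQ]
  have heval := congrArg (Polynomial.eval 1) hpoly
  have hgeom : ∀ m, Polynomial.eval 1 (geomPoly m) = (m : ℤ) := fun m => by
    rw [geomPoly, Polynomial.eval_finsetSum]
    simp
  rw [Polynomial.eval_mul, Polynomial.eval_prod, Polynomial.eval_prod] at heval
  simp only [hgeom] at heval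
  rw [← heval]
  congr 1
  have := PowerSeries.eval₂_trunc_eq_sum_range (1 : ℤ) (RingHom.id ℤ) (E.natDegree + 1) P
  simpa [Polynomial.eval₂_id] using this.symm

end SeriesQuotient

end LandauGinzburg

namespace LandauGinzburg

open MvPolynomial

/-! ### Monomial bases of complete intersections. -/

section MonomialBasis

variable {n : ℕ} {w : Fin n → ℤ}

/-- The monomials with exponents in `S` span the polynomial ring modulo the submodule `T`. -/
def SpansMod {B : Type} [CommRing B] (S : Finset (Fin n →₀ ℕ))
    (T : Submodule B (MvPolynomial (Fin n) B)) : Prop :=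
  ∀ m, monomial m (1 : B) ∈ restrictSupport B (S : Set (Fin n →₀ ℕ)) ⊔ T

theorem exists_homogeneous_of_spansMod {B : Type} [CommRing B]
    {S : Finset (Fin n →₀ ℕ)} {J : Ideal (MvPolynomial (Fin n) B)} (hJ : IsHomog w J)
    {m : Fin n →₀ ℕ}
    (hm : monomial m (1 : B) ∈ restrictSupport B (S : Set (Fin n →₀ ℕ)) ⊔ J.restrictScalars B) :
    ∃ a ∈ restrictSupport B {s | s ∈ S ∧ Finsupp.weight w s = Finsupp.weight w m},
      monomial m (1 : B) - a ∈ J := by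
  obtain ⟨a, ha, b, hb, hab⟩ := Submodule.mem_sup.1 hm
  refine ⟨weightedHomogeneousComponent w (Finsupp.weight w m) a, ?_, ?_⟩
  · rw [mem_restrictSupport_iff] at ha ⊢
    intro s hs
    rw [Finset.mem_coe, support_weightedHomogeneousComponent, Finset.mem_filter] at hs
    exact ⟨ha hs.1, hs.2⟩
  · have h1 : IsWeightedHomogeneous w (monomial m (1 : B)) (Finsupp.weight w m) :=
      isWeightedHomogeneous_monomial _ _ _ rfl
    have h2 := congrArg (weightedHomogeneousComponent w (Finsupp.weight w m)) hab
    rw [h1.weightedHomogeneousComponent_same, map_add] at h2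
    rw [← h2, add_sub_cancel_left]
    exact hJ b hb _

variable {K : Type} [Field K]

theorem gradedPiece_eq_span (J : Ideal (MvPolynomial (Fin n) K)) (d : ℤ) :
    gradedPiece w J d = Submodule.span K (Set.range
      fun m : {m : Fin n →₀ ℕ // Finsupp.weight w m = d} =>
        Ideal.Quotient.mk J (monomial m.1 (1 : K))) := by
  apply le_antisymm
  · rintro _ ⟨p, hp, rfl⟩
    rw [p.as_sum, map_sum]
    refine Submodule.sum_mem _ fun m hm => ?_
    rw [← mul_one (coeff m p), ← smul_eq_mul, ← smul_monomial, map_smul]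
    exact Submodule.smul_mem _ _ (Submodule.subset_span ⟨⟨m, hp (mem_support_iff.1 hm)⟩, rfl⟩)
  · rw [Submodule.span_le]
    rintro _ ⟨m, rfl⟩
    exact ⟨_, isWeightedHomogeneous_monomial _ _ _ m.2, rfl⟩

/-- The monomials of weight d span the graded piece, so a basis can be extracted from them. -/
theorem exists_finset_gradedPiece (hw : ∀ i, 0 < w i) (J : Ideal (MvPolynomial (Fin n) K)) (d : ℤ) :
    ∃ S : Finset (Fin n →₀ ℕ), (∀ s ∈ S, Finsupp.weight w s = d) ∧ S.card = hilb w J d ∧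
      gradedPiece w J d ≤
        Submodule.span K ((fun m => Ideal.Quotient.mk J (monomial m (1 : K))) '' S) := by
  classical
  obtain ⟨κ, a, ha, hspan, hli⟩ := exists_linearIndependent' K
    (fun m : {m : Fin n →₀ ℕ // Finsupp.weight w m = d} =>
        Ideal.Quotient.mk J (monomial m.1 (1 : K)))
  have hfin : Finite {m : Fin n →₀ ℕ // Finsupp.weight w m = d} :=
    ((finite_weight_le hw d).subset fun m hm => (show Finsupp.weight w m = d from hm).le).to_subtype
  have := Finite.of_injective a ha
  have := Fintype.ofFinite κ
  refine ⟨Finset.univ.image fun k => (a k).1, ?_, ?_, ?_⟩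
  · intro s hs
    obtain ⟨k, _, rfl⟩ := Finset.mem_image.1 hs
    exact (a k).2
  · rw [Finset.card_image_of_injective _ (f := fun k => (a k).1)
      (Subtype.val_injective.comp ha), Finset.card_univ,
      hilb, gradedPiece_eq_span, ← hspan, finrank_span_eq_card hli]
  · rw [gradedPiece_eq_span, ← hspan, Submodule.span_le]
    rintro _ ⟨k, rfl⟩
    exact Submodule.subset_span ⟨_, by simp, rfl⟩

theorem gradedPiece_eq_span_of_spansMod (J : Ideal (MvPolynomial (Fin n) K)) (hJ : IsHomog w J)
    {S : Finset (Fin n →₀ ℕ)} (hS : SpansMod S (J.restrictScalars K)) (d : ℤ) :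
    gradedPiece w J d = Submodule.span K
        (Set.range fun s : {s // s ∈ {s ∈ S | Finsupp.weight w s = d}} =>
        Ideal.Quotient.mk J (monomial s.1 (1 : K))) := by
  apply le_antisymm
  · rw [gradedPiece_eq_span, Submodule.span_le]
    rintro _ ⟨⟨m, rfl⟩, rfl⟩
    obtain ⟨a, ha, hma⟩ := exists_homogeneous_of_spansMod hJ (hS m)
    rw [← Ideal.Quotient.mk_eq_mk_iff_sub_mem] at hma
    simp only [hma]
    rw [restrictSupport_eq_span] at ha
    have h2 := Submodule.mem_map_of_mem (f := (Ideal.Quotient.mkₐ K J).toLinearMap) ha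
    rw [Submodule.map_span] at h2
    refine Submodule.span_mono ?_ h2
    rintro _ ⟨_, ⟨s, hs, rfl⟩, rfl⟩
    exact ⟨⟨s, Finset.mem_filter.2 hs⟩, rfl⟩
  · rw [Submodule.span_le]
    rintro _ ⟨s, rfl⟩
    exact ⟨_, isWeightedHomogeneous_monomial _ _ _ (Finset.mem_filter.1 s.2).2, rfl⟩

/-- The Hilbert series of a complete intersection of homogeneous polynomials of degrees `e`. -/
def expectedSeries (K : Type) [Field K] (w : Fin n → ℤ) (e : Fin n → ℕ) : PowerSeries ℤ :=
  hilbSeries w (⊥ : Ideal (MvPolynomial (Fin n) K)) * ∏ i, (1 - PowerSeries.X ^ e i)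

variable {v e : Fin n → ℕ} {r : Fin n → MvPolynomial (Fin n) K}

theorem isWeightedHomogeneous_extendZero
    (hr : ∀ i, IsWeightedHomogeneous w (r i) (e i : ℤ)) :
    ∀ k < n, IsWeightedHomogeneous w (extendZero r k) ((extendZero e k : ℕ) : ℤ) := by
  intro k hk
  rw [extendZero_of_lt r hk, extendZero_of_lt e hk]
  exact hr _

theorem expectedSeries_eq_prod_range :
    expectedSeries K w e = hilbSeries w (⊥ : Ideal (MvPolynomial (Fin n) K)) *
      ∏ k ∈ Finset.range n, (1 - PowerSeries.X ^ extendZero e k) := by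
  rw [Finset.prod_range]
  simp only [extendZero_of_lt _ (Fin.is_lt _), Fin.eta]
  rfl

theorem isHomog_span_range (hr : ∀ i, IsWeightedHomogeneous w (r i) (e i : ℤ)) :
    IsHomog w (Ideal.span (Set.range r)) := by
  rw [← prefixIdeal_extendZero]
  exact isHomog_prefixIdeal (isWeightedHomogeneous_extendZero hr) n le_rfl

/-- A complete intersection has a finite basis of monomials; its size is the product of the
degrees of the equations divided by the product of the weights. -/
theorem exists_monomialBasis (hv : ∀ i, 0 < v i) (hwv : ∀ i, w i = v i)
    (hr : ∀ i, IsWeightedHomogeneous w (r i) (e i : ℤ))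
    (hreg : RegSeq (extendZero r) n) :
    ∃ S : Finset (Fin n →₀ ℕ),
      SpansMod S ((Ideal.span (Set.range r)).restrictScalars K) ∧
      (∀ d : ℕ, (({s ∈ S | Finsupp.weight w s = d}.card : ℕ) : ℤ) ≤
        PowerSeries.coeff d (expectedSeries K w e)) ∧
      S.card * ∏ i, v i = ∏ i, e i := by
  classical
  have hw : ∀ i, 0 < w i := fun i => by rw [hwv]; exact_mod_cast hv i
  set J := Ideal.span (Set.range r) with hJ
  have hser : hilbSeries w J = expectedSeries K w e := by
    rw [hJ, ← prefixIdeal_extendZero, expectedSeries_eq_prod_range]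
    exact hilbSeries_of_regSeq hw (isWeightedHomogeneous_extendZero hr) hreg
  have hcoeff : ∀ d : ℕ, PowerSeries.coeff d (expectedSeries K w e) = hilb w J d := fun d => by
    rw [← hser, hilbSeries, PowerSeries.coeff_mk]
  obtain ⟨D, hD, hprod⟩ := sum_coeff_mul_prod (expectedSeries K w e) v e hv
    (fun d => by rw [hcoeff]; positivity)
    (by rw [expectedSeries, mul_right_comm, hilbSeries_bot_mul v hv hwv, one_mul])
  choose S hSw hScard hSspan using fun d : ℕ => exists_finset_gradedPiece hw J (d : ℤ)
  have hdisj : ∀ d d' : ℕ, d ≠ d' → Disjoint (S d) (S d') := by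
    intro d d' hdd
    rw [Finset.disjoint_left]
    intro s hs hs'
    have := (hSw d s hs).symm.trans (hSw d' s hs')
    exact hdd (by exact_mod_cast this)
  -- Beyond `D` the Hilbert function is zero, so each further `S d` is empty and nothing is lost.
  refine ⟨(Finset.range D).biUnion S, ?_, ?_, ?_⟩
  · intro m
    obtain ⟨d, hd⟩ := Int.eq_ofNat_of_zero_le (weight_nonneg hw m)
    have h1 : Ideal.Quotient.mk J (monomial m (1 : K)) ∈ gradedPiece w J (d : ℤ) :=
      ⟨_, isWeightedHomogeneous_monomial _ _ _ hd, rfl⟩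
    have hsub : (S d : Set (Fin n →₀ ℕ)) ⊆ (Finset.range D).biUnion S := by
      intro s hs
      have hlt : d < D := by
        by_contra hge
        have h0 := hD d (not_lt.1 hge)
        rw [hcoeff, ← hScard] at h0
        have h2 : S d = ∅ := Finset.card_eq_zero.1 (by exact_mod_cast h0)
        rw [h2] at hs
        simp at hs
      exact Finset.mem_coe.2 (Finset.mem_biUnion.2 ⟨d, Finset.mem_range.2 hlt, hs⟩)
    have h2 := hSspan d h1
    have h3 : ((fun m => Ideal.Quotient.mk J (monomial m (1 : K))) '' (S d : Set (Fin n →₀ ℕ))) =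
        (Ideal.Quotient.mkₐ K J).toLinearMap '' ((monomial · (1 : K)) '' (S d)) := by
      rw [Set.image_image]
      rfl
    rw [h3, ← Submodule.map_span, ← restrictSupport_eq_span] at h2
    obtain ⟨a, ha, hma⟩ := h2
    have hma' : Ideal.Quotient.mk J (monomial m 1) = Ideal.Quotient.mk J a := hma.symm
    rw [Ideal.Quotient.mk_eq_mk_iff_sub_mem] at hma'
    rw [← add_sub_cancel a (monomial m (1 : K))]
    exact Submodule.add_mem_sup (restrictSupport_mono K hsub ha) hma'
  · intro d
    rw [hcoeff, ← hScard]
    refine Int.ofNat_le.2 (Finset.card_le_card fun s hs => ?_)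
    rw [Finset.mem_filter, Finset.mem_biUnion] at hs
    obtain ⟨⟨d', _, hs'⟩, hsd⟩ := hs
    have : d' = d := by exact_mod_cast (hSw d' s hs').symm.trans hsd
    rwa [← this]
  · rw [Finset.card_biUnion fun d _ d' _ hdd => hdisj d d' hdd]
    have : (((∑ d ∈ Finset.range D, (S d).card) * ∏ i, v i : ℕ) : ℤ) = ((∏ i, e i : ℕ) : ℤ) := by
      push_cast
      rw [← hprod]
      congr 1
      exact Finset.sum_congr rfl fun d _ => by rw [hcoeff, hScard]
    exact_mod_cast this

/-- If a set of monomials of the expected size spans modulo the ideal of homogeneous polynomials of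
positive degrees, then these form a weakly regular sequence and the monomials are independent. -/
theorem regSeq_of_spansMod (hv : ∀ i, 0 < v i) (hwv : ∀ i, w i = v i)
    (hr : ∀ i, IsWeightedHomogeneous w (r i) (e i : ℤ))
    (he : ∀ i, 0 < e i) {S : Finset (Fin n →₀ ℕ)}
    (hS : SpansMod S ((Ideal.span (Set.range r)).restrictScalars K))
    (hcard : ∀ d : ℕ, (({s ∈ S | Finsupp.weight w s = d}.card : ℕ) : ℤ) ≤
        PowerSeries.coeff d (expectedSeries K w e)) :
    RegSeq (extendZero r) n ∧
      ∀ a ∈ restrictSupport K (S : Set (Fin n →₀ ℕ)), a ∈ Ideal.span (Set.range r) → a = 0 := by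
  classical
  have hw : ∀ i, 0 < w i := fun i => by rw [hwv]; exact_mod_cast hv i
  set J := Ideal.span (Set.range r) with hJ
  have hJh : IsHomog w J := isHomog_span_range hr
  -- Spanning bounds the Hilbert function by the count of monomials, which `hcard` bounds by the
  -- expected series.
  have hle : ∀ d : ℕ, hilb w J d ≤ {s ∈ S | Finsupp.weight w s = d}.card := by
    intro d
    rw [hilb, gradedPiece_eq_span_of_spansMod J hJh hS d]
    exact (finrank_range_le_card _).trans (le_of_eq (Fintype.card_coe _))
  have hreg : RegSeq (extendZero r) n := by
    refine regSeq_of_hilbSeries_le hw (isWeightedHomogeneous_extendZero hr)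
      (fun k hk => by rw [extendZero_of_lt e hk]; exact he _) fun d => ?_
    rw [← expectedSeries_eq_prod_range, prefixIdeal_extendZero, ← hJ, hilbSeries,
      PowerSeries.coeff_mk]
    exact (Int.ofNat_le.2 (hle d)).trans (hcard d)
  refine ⟨hreg, fun a ha haJ => ?_⟩
  have hser : hilbSeries w J = expectedSeries K w e := by
    rw [hJ, ← prefixIdeal_extendZero, expectedSeries_eq_prod_range]
    exact hilbSeries_of_regSeq hw (isWeightedHomogeneous_extendZero hr) hreg
  ext m
  rw [coeff_zero]
  by_contra hm
  obtain ⟨d, hd⟩ := Int.eq_ofNat_of_zero_le (weight_nonneg hw m)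
  -- Regularity makes the Hilbert series equal to the expected one, so the spanning monomials of
  -- weight `d` are no more numerous than the dimension.
  have hli : LinearIndependent K fun s : {s // s ∈ {s ∈ S | Finsupp.weight w s = d}} =>
      Ideal.Quotient.mk J (monomial s.1 (1 : K)) := by
    rw [linearIndependent_iff_card_le_finrank_span, Fintype.card_coe, Set.finrank,
      ← gradedPiece_eq_span_of_spansMod J hJh hS d]
    have h1 := hcard d
    rw [← hser, hilbSeries, PowerSeries.coeff_mk] at h1
    exact_mod_cast h1
  set b := weightedHomogeneousComponent w d a with hb
  have hbsupp : b.support ⊆ {s ∈ S | Finsupp.weight w s = d} := by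
    rw [hb, support_weightedHomogeneousComponent]
    exact Finset.filter_subset_filter _ ((mem_restrictSupport_iff K).1 ha)
  have hbm : coeff m b = coeff m a := by
    rw [hb, coeff_weightedHomogeneousComponent, if_pos hd]
  have hmS : m ∈ ({s ∈ S | Finsupp.weight w s = d} : Finset _) :=
    hbsupp (mem_support_iff.2 (by rwa [hbm]))
  rw [Fintype.linearIndependent_iff] at hli
  refine hm ?_
  rw [← hbm]
  refine hli (fun s => coeff s.1 b) ?_ ⟨m, hmS⟩
  rw [Finset.sum_coe_sort {s ∈ S | Finsupp.weight w s = d}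
    (fun s => coeff s b • Ideal.Quotient.mk J (monomial s (1 : K)))]
  have hsum : b = ∑ s ∈ S with Finsupp.weight w s = d, coeff s b • monomial s (1 : K) := by
    conv_lhs => rw [b.as_sum]
    refine (Finset.sum_subset hbsupp fun s _ hs => ?_).trans (Finset.sum_congr rfl fun s _ => ?_)
    · rw [notMem_support_iff.1 hs, map_zero]
    · rw [smul_monomial, smul_eq_mul, mul_one]
  have h0 : Ideal.Quotient.mkₐ K J b = 0 := Ideal.Quotient.eq_zero_iff_mem.2 (hJh a haJ d)
  rw [hsum, map_sum] at h0
  exact h0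

end MonomialBasis

end LandauGinzburg

namespace LandauGinzburg

open MvPolynomial

/-! ### Koszul syzygies and the square of the twisted differential. -/

section Koszul

variable {A : Type} [CommRing A]

theorem exists_sum_of_mem_prefixIdeal (r : ℕ → A) (m : ℕ) {x : A} (hx : x ∈ prefixIdeal r m) :
    ∃ c : ℕ → A, x = ∑ i ∈ Finset.range m, c i * r i := by
  induction m generalizing x with
  | zero =>
    rw [prefixIdeal_zero, Ideal.mem_bot] at hx
    exact ⟨0, by simp [hx]⟩
  | succ m ih =>
    rw [prefixIdeal_succ] at hx
    obtain ⟨a, ha, b, hb, rfl⟩ := Submodule.mem_sup.1 hx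
    obtain ⟨c, rfl⟩ := ih ha
    obtain ⟨y, rfl⟩ := Ideal.mem_span_singleton'.1 hb
    refine ⟨fun i => if i = m then y else c i, ?_⟩
    rw [Finset.sum_range_succ]
    beta_reduce
    rw [if_pos rfl]
    congr 1
    refine Finset.sum_congr rfl fun i hi => ?_
    rw [if_neg (Finset.mem_range.1 hi).ne]

/-- The relations between the elements of a regular sequence are generated by the trivial ones. -/
theorem exists_antisymm_of_regSeq (r : ℕ → A) (m : ℕ) (hr : RegSeq r m) (g : ℕ → A)
    (hg : ∑ i ∈ Finset.range m, g i * r i = 0) :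
    ∃ a : ℕ → ℕ → A, (∀ i j, a i j = -a j i) ∧ (∀ i, a i i = 0) ∧
      ∀ i < m, g i = ∑ j ∈ Finset.range m, a i j * r j := by
  induction m generalizing g with
  | zero => exact ⟨0, by simp, by simp, by simp⟩
  | succ m ih =>
    rw [Finset.sum_range_succ] at hg
    have hmem : g m * r m ∈ prefixIdeal r m := by
      rw [eq_neg_of_add_eq_zero_right hg]
      refine neg_mem (sum_mem fun i hi => Ideal.mul_mem_left _ _ (Ideal.subset_span ⟨i, ?_, rfl⟩))
      exact Finset.mem_range.1 hi
    obtain ⟨c, hc⟩ := exists_sum_of_mem_prefixIdeal r m (hr m (Nat.lt_succ_self m) _ hmem)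
    -- Substituting g_m = ∑ c_i r_i into the relation leaves a shorter relation with coefficients
    -- g_i + c_i r_m.
    obtain ⟨a, ha, ha0, hag⟩ := ih (fun k hk => hr k (hk.trans (Nat.lt_succ_self m)))
      (fun i => g i + c i * r m) (by
        rw [← hg, hc, Finset.sum_mul, ← Finset.sum_add_distrib]
        exact Finset.sum_congr rfl fun i _ => by ring)
    -- The matrix from the shorter relation is bordered by the row `c` and the column `-c`.
    refine ⟨fun i j => if i = m then (if j = m then 0 else c j) else
      if j = m then -c i else a i j, ?_, ?_, ?_⟩
    · intro i j
      dsimp only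
      split_ifs <;> simp [ha i j]
    · intro i
      dsimp only
      split_ifs <;> simp [ha0 i]
    · intro i hi
      rw [Finset.sum_range_succ]
      by_cases him : i = m
      · subst him
        simp only [if_true, zero_mul, add_zero]
        rw [hc]
        refine Finset.sum_congr rfl fun j hj => ?_
        rw [if_neg (Finset.mem_range.1 hj).ne]
      · simp only [if_neg him, if_true]
        have h1 := hag i (by omega)
        have h2 : ∑ j ∈ Finset.range m, (if j = m then -c i else a i j) * r j =
            ∑ j ∈ Finset.range m, a i j * r j :=
          Finset.sum_congr rfl fun j hj => by rw [if_neg (Finset.mem_range.1 hj).ne]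
        rw [h2, ← h1]
        ring

/-- Terms cancel in pairs (i, j), (j, i). The diagonal is assumed zero because antisymmetry only
gives 2 T i i = 0. -/
theorem sum_sum_eq_zero_of_antisymm {ι : Type} [Fintype ι] (T : ι → ι → A)
    (hT : ∀ i j, T i j = -T j i) (hT0 : ∀ i, T i i = 0) : ∑ i, ∑ j, T i j = 0 := by
  rw [← Fintype.sum_prod_type']
  refine Finset.sum_involution (fun x _ => (x.2, x.1)) ?_ ?_ ?_ ?_
  · rintro ⟨i, j⟩ _
    rw [hT i j]
    simp
  · rintro ⟨i, j⟩ _ hne h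
    obtain rfl : j = i := congrArg Prod.fst h
    exact hne (hT0 j)
  · simp
  · simp

/-- The twisted differential squares to zero, in top degree. -/
theorem twistedDiv_koszul {n : ℕ} (z : A) (f : MvPolynomial (Fin n) A)
    (a : Fin n → Fin n → MvPolynomial (Fin n) A) (ha : ∀ i j, a i j = -a j i)
    (ha0 : ∀ i, a i i = 0) :
    twistedDiv A n z f (fun l => ∑ k, (a l k * pderiv k f + z • pderiv k (a l k))) = 0 := by
  rw [twistedDiv_apply]
  have h : ∀ l, (∑ k, (a l k * pderiv k f + z • pderiv k (a l k))) * pderiv l f +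
      z • pderiv l (∑ k, (a l k * pderiv k f + z • pderiv k (a l k))) =
      ∑ k, ((a l k * pderiv k f + z • pderiv k (a l k)) * pderiv l f +
        z • pderiv l (a l k * pderiv k f + z • pderiv k (a l k))) := by
    intro l
    rw [Finset.sum_mul, map_sum, Finset.smul_sum, Finset.sum_add_distrib]
  simp only [h]
  have hcomm : ∀ (i j : Fin n) (p : MvPolynomial (Fin n) A),
      pderiv i (pderiv j p) = pderiv j (pderiv i p) := by
    intro i j p
    have h0 : ⁅pderiv (R := A) i, pderiv (R := A) j⁆ = 0 := by
      refine derivation_ext fun k => ?_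
      rw [Derivation.commutator_apply]
      simp [pderiv_X, Pi.single_apply, apply_ite]
    have h1 := congrArg
        (fun D : Derivation A (MvPolynomial (Fin n) A) (MvPolynomial (Fin n) A) => D p) h0
    rw [Derivation.commutator_apply] at h1
    exact sub_eq_zero.1 h1
  -- After the Leibniz rule, swapping the indices changes the sign of each summand: `a` is
  -- antisymmetric and the partial derivatives commute.
  apply sum_sum_eq_zero_of_antisymm
  · intro i j
    rw [ha i j]
    simp only [map_neg, map_add, Derivation.leibniz, smul_eq_mul, smul_eq_C_mul,
      pderiv_C, hcomm j i]
    ring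
  · intro i
    simp [ha0]

end Koszul

/-! ### Independence modulo the twisted differential. -/

section Filtration

variable {n : ℕ} {w : Fin n → ℤ} {B : Type} [CommRing B]

/-- The polynomials all of whose monomials have weight less than `d`. -/
def ltDeg (B : Type) [CommRing B] (w : Fin n → ℤ) (d : ℤ) : Submodule B (MvPolynomial (Fin n) B) :=
  restrictSupport B {m | Finsupp.weight w m < d}

theorem mem_ltDeg {d : ℤ} {p : MvPolynomial (Fin n) B} :
    p ∈ ltDeg B w d ↔ ∀ m ∈ p.support, Finsupp.weight w m < d := Iff.rfl

theorem mem_ltDeg_iff_component {d : ℤ} {p : MvPolynomial (Fin n) B} :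
    p ∈ ltDeg B w d ↔ ∀ k ≥ d, weightedHomogeneousComponent w k p = 0 := by
  rw [mem_ltDeg]
  constructor
  · intro h k hk
    exact weightedHomogeneousComponent_eq_zero' _ _ fun m hm => ((h m hm).trans_le hk).ne
  · intro h m hm
    by_contra hlt
    have h1 := congrArg (coeff m) (h _ (not_lt.1 hlt))
    rw [coeff_weightedHomogeneousComponent, if_pos rfl, coeff_zero] at h1
    exact mem_support_iff.1 hm h1

theorem ltDeg_mono {d d' : ℤ} (h : d ≤ d') : ltDeg B w d ≤ ltDeg B w d' :=
  restrictSupport_mono B fun _ hm => lt_of_lt_of_le hm h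

/-- The bound `d + 1` means weight at most `d`; only one factor has to be strictly lower for the
product to be so. -/
theorem mul_mem_ltDeg {d d' : ℤ} {p q : MvPolynomial (Fin n) B} (hp : p ∈ ltDeg B w (d + 1))
    (hq : q ∈ ltDeg B w d') : p * q ∈ ltDeg B w (d + d') := by
  classical
  intro m hm
  obtain ⟨a, ha, b, hb, rfl⟩ := Finset.mem_add.1 (support_mul p q hm)
  have h1 : Finsupp.weight w a < d + 1 := hp ha
  have h2 : Finsupp.weight w b < d' := hq hb
  change Finsupp.weight w (a + b) < d + d'
  rw [map_add]
  omega

theorem pderiv_mem_ltDeg {d : ℤ} {p : MvPolynomial (Fin n) B} (hp : p ∈ ltDeg B w d) (i : Fin n) :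
    pderiv i p ∈ ltDeg B w (d - w i) := by
  rw [mem_ltDeg_iff_component] at hp ⊢
  intro k hk
  rw [weightedHomogeneousComponent_pderiv, hp _ (by omega), map_zero]

theorem sub_component_mem_ltDeg {d : ℤ} {p : MvPolynomial (Fin n) B}
    (hp : p ∈ ltDeg B w (d + 1)) : p - weightedHomogeneousComponent w d p ∈ ltDeg B w d := by
  rw [mem_ltDeg_iff_component] at hp ⊢
  intro k hk
  rw [map_sub, weightedHomogeneousComponent_of_mem (weightedHomogeneousComponent_mem w p d)]
  split_ifs with h
  · rw [h, sub_self]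
  · rw [hp k (by omega), sub_zero]

theorem component_mem_ltDeg (d : ℤ) (p : MvPolynomial (Fin n) B) :
    weightedHomogeneousComponent w d p ∈ ltDeg B w (d + 1) := by
  intro m hm
  have := weightedHomogeneousComponent_isWeightedHomogeneous d p (mem_support_iff.1 hm)
  exact lt_of_eq_of_lt this (lt_add_one d)

theorem component_eq_zero_of_mem_ltDeg {d : ℤ} {p : MvPolynomial (Fin n) B}
    (hp : p ∈ ltDeg B w d) : weightedHomogeneousComponent w d p = 0 :=
  mem_ltDeg_iff_component.1 hp d le_rfl

/-- Koszul coefficients may be replaced by their components of the right degree, since the r_i and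
g_i are homogeneous. The degree is what makes the correction in the descent below lower-order. -/
theorem exists_koszul_homogeneous {r : Fin n → MvPolynomial (Fin n) B} {e : Fin n → ℤ}
    (hr : ∀ i, IsWeightedHomogeneous w (r i) (e i)) (hreg : RegSeq (extendZero r) n) {d : ℤ}
    {g : Fin n → MvPolynomial (Fin n) B} (hg : ∀ i, IsWeightedHomogeneous w (g i) (d - e i))
    (hsum : ∑ i, g i * r i = 0) :
    ∃ a : Fin n → Fin n → MvPolynomial (Fin n) B, (∀ i j, a i j = -a j i) ∧ (∀ i, a i i = 0) ∧
      (∀ i j, IsWeightedHomogeneous w (a i j) (d - e i - e j)) ∧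
      ∀ i, g i = ∑ j, a i j * r j := by
  obtain ⟨a, ha, ha0, hag⟩ := exists_antisymm_of_regSeq (extendZero r) n hreg (extendZero g) (by
    rw [Finset.sum_range, ← hsum]
    simp only [extendZero_of_lt _ (Fin.is_lt _), Fin.eta])
  refine ⟨fun i j => weightedHomogeneousComponent w (d - e i - e j) (a i j), ?_, ?_, ?_, ?_⟩
  · intro i j
    beta_reduce
    rw [ha i j, map_neg, sub_right_comm]
  · intro i
    beta_reduce
    rw [ha0, map_zero]
  · intro i j
    exact weightedHomogeneousComponent_isWeightedHomogeneous _ _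
  · intro i
    have h1 := hag i i.2
    rw [Finset.sum_range] at h1
    simp only [extendZero_of_lt _ (Fin.is_lt _), Fin.eta] at h1
    rw [← (hg i).weightedHomogeneousComponent_same, h1, map_sum]
    exact Finset.sum_congr rfl fun j _ => weightedHomogeneousComponent_mul _ (hr j) _

/-- Independence of monomials modulo the Jacobian ideal of the leading term implies independence
modulo the image of the twisted differential. -/
theorem eq_zero_of_mem_range_twistedDiv {L : ℤ} (hw : ∀ i, 0 < w i) (hwL : ∀ i, w i < L)
    (z : B) {f : MvPolynomial (Fin n) B} (hf : f ∈ ltDeg B w (L + 1))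
    (hreg : RegSeq (extendZero fun l => pderiv l (weightedHomogeneousComponent w L f)) n)
    {S : Set (Fin n →₀ ℕ)}
    (hind : ∀ a ∈ restrictSupport B S,
      a ∈ Ideal.span (Set.range fun l => pderiv l (weightedHomogeneousComponent w L f)) → a = 0)
    {a : MvPolynomial (Fin n) B} (ha : a ∈ restrictSupport B S)
    (hrange : a ∈ LinearMap.range (twistedDiv B n z f)) : a = 0 := by
  set F := weightedHomogeneousComponent w L f with hF
  have hFhom : ∀ l, IsWeightedHomogeneous w (pderiv l F) (L - w l) := fun l =>
    (weightedHomogeneousComponent_isWeightedHomogeneous L f).pderiv (sub_add_cancel _ _)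
  have hf0 : ∀ l, pderiv l f - pderiv l F ∈ ltDeg B w (L - w l) := fun l => by
    rw [← map_sub]
    exact pderiv_mem_ltDeg (sub_component_mem_ltDeg hf) l
  -- Descent on `D`, a strict bound for the weights of the products g_l ∂_l F. At `D = 0` the
  -- weights in g_l would be below -(L - w l) < 0, so g = 0.
  suffices h : ∀ (D : ℕ) (g : Fin n → MvPolynomial (Fin n) B),
      (∀ l, g l ∈ ltDeg B w (D - (L - w l))) → a = twistedDiv B n z f g → a = 0 by
    obtain ⟨g, hg⟩ := hrange
    obtain ⟨D, hD⟩ : ∃ D : ℕ, ∀ l, ∀ m ∈ (g l).support, Finsupp.weight w m + L < D := by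
      let s : Finset (Fin n →₀ ℕ) := Finset.univ.biUnion fun l => (g l).support
      refine ⟨(∑ m ∈ s, Finsupp.weight w m + L).toNat + 1, fun l m hm => ?_⟩
      have h1 : Finsupp.weight w m ≤ ∑ m ∈ s, Finsupp.weight w m :=
        Finset.single_le_sum (fun m _ => weight_nonneg hw m)
          (Finset.mem_biUnion.2 ⟨l, Finset.mem_univ _, hm⟩)
      push_cast
      have := Int.self_le_toNat (∑ m ∈ s, Finsupp.weight w m + L)
      omega
    refine h D g (fun l m hm => ?_) hg.symm
    have h1 := hD l m hm
    have h2 := hw l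
    change Finsupp.weight w m < _
    omega
  intro D
  induction D with
  | zero =>
    intro g hg hag
    have hg0 : g = 0 := by
      funext l
      ext m
      by_contra hm
      have h1 : Finsupp.weight w m < ((0 : ℕ) : ℤ) - (L - w l) := hg l (mem_support_iff.2 hm)
      have h2 := weight_nonneg hw m
      have h3 := hwL l
      push_cast at h1
      omega
    rw [hag, hg0, map_zero]
  | succ D ih =>
    intro g hg hag
    have hg' : ∀ l, g l ∈ ltDeg B w (D - (L - w l) + 1) := fun l => by
      have := hg l
      rwa [Nat.cast_succ, add_sub_right_comm] at this
    set u : Fin n → MvPolynomial (Fin n) B :=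
      fun l => weightedHomogeneousComponent w (D - (L - w l)) (g l) with hu
    have huhom : ∀ l, IsWeightedHomogeneous w (u l) (D - (L - w l)) := fun l =>
      weightedHomogeneousComponent_isWeightedHomogeneous _ _
    have hgu : ∀ l, g l - u l ∈ ltDeg B w (D - (L - w l)) := fun l =>
      sub_component_mem_ltDeg (hg' l)
    -- Everything but the leading products has smaller weight: ∂_l f - ∂_l F and g_l - u_l drop
    -- below top weight, and ∂_l g_l is L lower than g_l ∂_l F.
    have htop : a - ∑ l, u l * pderiv l F ∈ ltDeg B w D := by
      rw [hag, twistedDiv_apply, ← Finset.sum_sub_distrib]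
      refine Submodule.sum_mem _ fun l _ => ?_
      have h1 : g l * pderiv l f + z • pderiv l (g l) - u l * pderiv l F =
          g l * (pderiv l f - pderiv l F) + pderiv l F * (g l - u l) + z • pderiv l (g l) := by
        ring
      rw [h1]
      refine Submodule.add_mem _ (Submodule.add_mem _ ?_ ?_) (Submodule.smul_mem _ _ ?_)
      · have := mul_mem_ltDeg (hg' l) (hf0 l)
        rwa [sub_add_cancel] at this
      · have h2 : pderiv l F ∈ ltDeg B w (L - w l + 1) := by
          rw [← (hFhom l).weightedHomogeneousComponent_same]
          exact component_mem_ltDeg _ _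
        have := mul_mem_ltDeg h2 (hgu l)
        rwa [add_sub_cancel] at this
      · refine ltDeg_mono ?_ (pderiv_mem_ltDeg (hg' l) l)
        have := hwL l
        have := hw l
        omega
    have hsumhom : weightedHomogeneousComponent w (D : ℤ) (∑ l, u l * pderiv l F) =
        ∑ l, u l * pderiv l F := by
      rw [map_sum]
      refine Finset.sum_congr rfl fun l _ => ?_
      rw [weightedHomogeneousComponent_mul _ (hFhom l), (huhom l).weightedHomogeneousComponent_same]
    have hcomp : weightedHomogeneousComponent w (D : ℤ) a = ∑ l, u l * pderiv l F := by
      have h1 := component_eq_zero_of_mem_ltDeg htop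
      rw [map_sub, hsumhom] at h1
      exact sub_eq_zero.1 h1
    -- This sum is a component of `a`, hence supported on `S`, and it lies in the Jacobian ideal of
    -- `F`, so `hind` applies.
    have hsum0 : ∑ l, u l * pderiv l F = 0 := by
      rw [← hcomp]
      refine hind _ ?_ ?_
      · rw [mem_restrictSupport_iff] at ha ⊢
        rw [support_weightedHomogeneousComponent]
        exact fun m hm => ha (Finset.mem_filter.1 hm).1
      · rw [hcomp]
        exact sum_mem fun l _ => Ideal.mul_mem_left _ _ (Ideal.subset_span ⟨l, rfl⟩)
    obtain ⟨A, hA, hA0, hAhom, hAu⟩ := exists_koszul_homogeneous hFhom hreg huhom hsum0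
    -- The twisted Koszul boundary of `A` has leading part `u`, so subtracting it lowers the bound;
    -- its image is zero by `twistedDiv_koszul`, so `a` is unchanged.
    refine ih (fun l => g l - ∑ k, (A l k * pderiv k f + z • pderiv k (A l k))) (fun l => ?_) ?_
    · have h1 : g l - ∑ k, (A l k * pderiv k f + z • pderiv k (A l k)) =
          (g l - u l) - ∑ k, (A l k * (pderiv k f - pderiv k F) + z • pderiv k (A l k)) := by
        rw [hAu l, sub_sub, ← Finset.sum_add_distrib]
        congr 1
        exact Finset.sum_congr rfl fun k _ => by ring
      rw [h1]
      refine Submodule.sub_mem _ (hgu l) (Submodule.sum_mem _ fun k _ => ?_)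
      have h2 : A l k ∈ ltDeg B w (D - (L - w l) - (L - w k) + 1) := by
        rw [← (hAhom l k).weightedHomogeneousComponent_same]
        exact component_mem_ltDeg _ _
      refine Submodule.add_mem _ ?_ (Submodule.smul_mem _ _ ?_)
      · have := mul_mem_ltDeg h2 (hf0 k)
        rwa [sub_add_cancel] at this
      · refine ltDeg_mono ?_ (pderiv_mem_ltDeg h2 k)
        have := hwL l
        have := hw l
        omega
    · have h1 : (fun l => g l - ∑ k, (A l k * pderiv k f + z • pderiv k (A l k))) =
          g - fun l => ∑ k, (A l k * pderiv k f + z • pderiv k (A l k)) := rfl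
      rw [h1, map_sub, twistedDiv_koszul z f A hA hA0, sub_zero, hag]

end Filtration

end LandauGinzburg

namespace LandauGinzburg

open MvPolynomial

/-! ### Spanning up to powers of a function on the base. -/

section AwaySat

variable {B M : Type} [CommRing B] [AddCommGroup M] [Module B M]

/-- The elements which lie in `T` after multiplication by a power of `h`. -/
def awaySat (h : B) (T : Submodule B M) : Submodule B M where
  carrier := {x | ∃ k : ℕ, h ^ k • x ∈ T}
  zero_mem' := ⟨0, by simp⟩
  add_mem' := by
    rintro x y ⟨k, hk⟩ ⟨j, hj⟩
    refine ⟨k + j, ?_⟩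
    rw [smul_add]
    refine T.add_mem ?_ ?_
    · rw [pow_add, mul_comm, mul_smul]
      exact T.smul_mem _ hk
    · rw [pow_add, mul_smul]
      exact T.smul_mem _ hj
  smul_mem' := by
    rintro c x ⟨k, hk⟩
    refine ⟨k, ?_⟩
    rw [smul_comm]
    exact T.smul_mem _ hk

theorem le_awaySat (h : B) (T : Submodule B M) : T ≤ awaySat h T :=
  fun x hx => ⟨0, by simpa using hx⟩

theorem mem_awaySat_of_pow_smul_mem {h : B} {T : Submodule B M} {x : M} (k : ℕ)
    (hx : h ^ k • x ∈ awaySat h T) : x ∈ awaySat h T := by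
  obtain ⟨j, hj⟩ := hx
  refine ⟨j + k, ?_⟩
  rwa [pow_add, mul_smul]

end AwaySat

section Spanning

variable {n : ℕ} {w : Fin n → ℤ} {B : Type} [CommRing B]

theorem mem_of_monomial_mem {T : Submodule B (MvPolynomial (Fin n) B)} {p : MvPolynomial (Fin n) B}
    (h : ∀ m ∈ p.support, monomial m (1 : B) ∈ T) : p ∈ T := by
  rw [p.as_sum]
  refine Submodule.sum_mem _ fun m hm => ?_
  rw [← mul_one (coeff m p), ← smul_eq_mul, ← smul_monomial]
  exact T.smul_mem _ (h m hm)

/-- A homogeneous element of the span of monomials plus a homogeneous ideal generated by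
homogeneous polynomials is so by homogeneous coefficients. -/
theorem exists_homogeneous_decomposition {r : Fin n → MvPolynomial (Fin n) B} {e : Fin n → ℤ}
    (hr : ∀ i, IsWeightedHomogeneous w (r i) (e i)) {S : Set (Fin n →₀ ℕ)} {d : ℤ}
    {p : MvPolynomial (Fin n) B} (hp : IsWeightedHomogeneous w p d)
    (hmem : p ∈ restrictSupport B S ⊔ (Ideal.span (Set.range r)).restrictScalars B) :
    ∃ a ∈ restrictSupport B S, ∃ g : Fin n → MvPolynomial (Fin n) B,
      IsWeightedHomogeneous w a d ∧ (∀ i, IsWeightedHomogeneous w (g i) (d - e i)) ∧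
      p = a + ∑ i, g i * r i := by
  obtain ⟨a, ha, b, hb, hab⟩ := Submodule.mem_sup.1 hmem
  obtain ⟨c, rfl⟩ := Ideal.mem_span_range_iff_exists_fun.1 hb
  refine ⟨weightedHomogeneousComponent w d a, ?_,
    fun i => weightedHomogeneousComponent w (d - e i) (c i),
    weightedHomogeneousComponent_isWeightedHomogeneous _ _,
    fun i => weightedHomogeneousComponent_isWeightedHomogeneous _ _, ?_⟩
  · rw [mem_restrictSupport_iff] at ha ⊢
    rw [support_weightedHomogeneousComponent]
    exact fun m hm => ha (Finset.mem_filter.1 hm).1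
  · rw [← hp.weightedHomogeneousComponent_same, ← hab, map_add, map_sum]
    congr 1
    exact Finset.sum_congr rfl fun i _ => weightedHomogeneousComponent_mul _ (hr i) _

/-- Spanning modulo the Jacobian ideal of the leading term implies spanning modulo the image of the
twisted differential. -/
theorem mem_awaySat_twistedDiv {L : ℤ} (hw : ∀ i, 0 < w i) (hL : 0 < L)
    (z : B) {f : MvPolynomial (Fin n) B} (hf : f ∈ ltDeg B w (L + 1)) (h : B)
    {S : Set (Fin n →₀ ℕ)}
    (hspan : ∀ m, monomial m (1 : B) ∈ awaySat h (restrictSupport B S ⊔ (Ideal.span (Set.range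
      fun l => pderiv l (weightedHomogeneousComponent w L f))).restrictScalars B))
    (p : MvPolynomial (Fin n) B) :
    p ∈ awaySat h (restrictSupport B S ⊔ LinearMap.range (twistedDiv B n z f)) := by
  set F := weightedHomogeneousComponent w L f with hF
  have hFhom : ∀ l, IsWeightedHomogeneous w (pderiv l F) (L - w l) := fun l =>
    (weightedHomogeneousComponent_isWeightedHomogeneous L f).pderiv (sub_add_cancel _ _)
  have hf0 : ∀ l, pderiv l f - pderiv l F ∈ ltDeg B w (L - w l) := fun l => by
    rw [← map_sub]
    exact pderiv_mem_ltDeg (sub_component_mem_ltDeg hf) l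
  set T := restrictSupport B S ⊔ LinearMap.range (twistedDiv B n z f) with hT
  suffices hmon : ∀ (d : ℕ) (m : Fin n →₀ ℕ), Finsupp.weight w m = d →
      monomial m (1 : B) ∈ awaySat h T by
    refine mem_of_monomial_mem fun m _ => ?_
    obtain ⟨d, hd⟩ := Int.eq_ofNat_of_zero_le (weight_nonneg hw m)
    exact hmon d m hd
  intro d
  induction d using Nat.strong_induction_on with
  | _ d ih =>
    intro m hm
    obtain ⟨k, hk⟩ := hspan m
    have hhom : IsWeightedHomogeneous w (h ^ k • monomial m (1 : B)) (d : ℤ) := by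
      rw [smul_monomial]
      exact isWeightedHomogeneous_monomial _ _ _ hm
    obtain ⟨a, ha, g, -, hg, hag⟩ := exists_homogeneous_decomposition hFhom hhom hk
    have hg' : ∀ l, g l ∈ ltDeg B w (d - (L - w l) + 1) := fun l => by
      rw [← (hg l).weightedHomogeneousComponent_same]
      exact component_mem_ltDeg _ _
    apply mem_awaySat_of_pow_smul_mem k
    -- Trading ∑ g_l ∂_l F for the twisted image of `g` costs an error of weight below `d`, to which
    -- the induction hypothesis applies.
    have hdecomp : h ^ k • monomial m (1 : B) = a + twistedDiv B n z f g -
        ∑ l, (g l * (pderiv l f - pderiv l F) + z • pderiv l (g l)) := by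
      rw [hag, twistedDiv_apply, add_sub_assoc, ← Finset.sum_sub_distrib]
      congr 1
      exact Finset.sum_congr rfl fun l _ => by ring
    rw [hdecomp]
    refine Submodule.sub_mem _ (le_awaySat h T (Submodule.add_mem_sup ha ⟨g, rfl⟩)) ?_
    have hlow : ∑ l, (g l * (pderiv l f - pderiv l F) + z • pderiv l (g l)) ∈ ltDeg B w d := by
      refine Submodule.sum_mem _ fun l _ => Submodule.add_mem _ ?_ (Submodule.smul_mem _ _ ?_)
      · have := mul_mem_ltDeg (hg' l) (hf0 l)
        rwa [sub_add_cancel] at this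
      · refine ltDeg_mono ?_ (pderiv_mem_ltDeg (hg' l) l)
        omega
    refine mem_of_monomial_mem fun m' hm' => ?_
    have h1 := mem_ltDeg.1 hlow m' hm'
    obtain ⟨d', hd'⟩ := Int.eq_ofNat_of_zero_le (weight_nonneg hw m')
    exact ih d' (by omega) m' hd'

/-- Spanning in bounded degrees implies spanning in all degrees. -/
theorem mem_awaySat_of_bounded {D : ℤ} (hD : 0 ≤ D) (h : B) {S : Set (Fin n →₀ ℕ)}
    (hSD : ∀ s ∈ S, ∀ i, Finsupp.weight w s + w i ≤ D) {J : Ideal (MvPolynomial (Fin n) B)}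
    (hspan : ∀ m, Finsupp.weight w m ≤ D →
      monomial m (1 : B) ∈ awaySat h (restrictSupport B S ⊔ J.restrictScalars B))
    (p : MvPolynomial (Fin n) B) :
    p ∈ awaySat h (restrictSupport B S ⊔ J.restrictScalars B) := by
  induction p using MvPolynomial.induction_on with
  | C a =>
    rw [← mul_one (C a), ← smul_eq_C_mul]
    exact Submodule.smul_mem _ _ (hspan 0 (by simpa using hD))
  | add p q hp hq => exact Submodule.add_mem _ hp hq
  | mul_X p i hp =>
    obtain ⟨k, hk⟩ := hp
    apply mem_awaySat_of_pow_smul_mem k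
    obtain ⟨a, ha, b, hb, hab⟩ := Submodule.mem_sup.1 hk
    -- A multiple of `p` is a combination of `S` modulo `J`; multiplying by X_i moves monomials of
    -- `S` to weight at most `D`, where spanning is assumed.
    rw [← smul_mul_assoc, ← hab, add_mul]
    refine Submodule.add_mem _ ?_ (le_awaySat _ _ (Submodule.mem_sup_right (J.mul_mem_right _ hb)))
    refine mem_of_monomial_mem fun m hm => ?_
    classical
    rw [support_mul_X, Finset.mem_map] at hm
    obtain ⟨s, hs, rfl⟩ := hm
    refine hspan _ ?_
    have h1 := hSD s (ha hs) i
    rw [addRightEmbedding_apply, map_add, Finsupp.weight_single, one_smul]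
    exact h1

end Spanning

/-! ### Spreading out from a point. -/

section Nakayama

variable {n : ℕ} {w : Fin n → ℤ} {K A : Type} [Field K] [CommRing A] [Algebra K A]

theorem isWeightedHomogeneous_map {B B' : Type} [CommRing B] [CommRing B'] (ψ : B →+* B') {d : ℤ}
    {p : MvPolynomial (Fin n) B} (hp : IsWeightedHomogeneous w p d) :
    IsWeightedHomogeneous w (map ψ p) d :=
  fun m hm => hp fun h0 => hm (by rw [coeff_map, h0, map_zero])

/-- If monomials span modulo the Jacobian ideal of `F` at a point, then they span in a neighbourhood
of the point, in bounded degrees. -/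
theorem exists_smul_mem_of_spansMod (hw : ∀ i, 0 < w i) {L : ℤ} (φ : A →ₐ[K] K)
    {F : MvPolynomial (Fin n) A} (hF : IsWeightedHomogeneous w F L) {S : Finset (Fin n →₀ ℕ)}
    (hS : SpansMod S ((Ideal.span (Set.range fun l =>
      pderiv l (map (φ : A →+* K) F))).restrictScalars K)) (D : ℤ) :
    ∃ h : A, φ h = 1 ∧ ∀ m, Finsupp.weight w m ≤ D →
      h • monomial m (1 : A) ∈ restrictSupport A (S : Set (Fin n →₀ ℕ)) ⊔
        (Ideal.span (Set.range fun l => pderiv l F)).restrictScalars A := by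
  set T := restrictSupport A (S : Set (Fin n →₀ ℕ)) ⊔
        (Ideal.span (Set.range fun l => pderiv l F)).restrictScalars A with hT
  let P : Submodule A (MvPolynomial (Fin n) A) := restrictSupport A {m | Finsupp.weight w m ≤ D}
  have hfg : P.FG := by
    refine ⟨((finite_weight_le hw D).image fun m => monomial m (1 : A)).toFinset, ?_⟩
    rw [Set.Finite.coe_toFinset, ← restrictSupport_eq_span]
  have hFhom : ∀ l, IsWeightedHomogeneous w (pderiv l (map (φ : A →+* K) F)) (L - w l) := fun l =>
    (isWeightedHomogeneous_map _ hF).pderiv (sub_add_cancel _ _)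
  -- The bounded-degree part of the quotient is finitely generated. It equals its multiple by the
  -- maximal ideal of the point, so Nakayama gives `h` with value 1 at the point which annihilates
  -- it.
  have hle : P.map T.mkQ ≤ (RingHom.ker φ) • P.map T.mkQ := by
    rw [Submodule.map_le_iff_le_comap]
    intro p hp
    refine mem_of_monomial_mem fun m hm => ?_
    have hmD : Finsupp.weight w m ≤ D := hp hm
    have hhom : IsWeightedHomogeneous w (monomial m (1 : K)) (Finsupp.weight w m) :=
      isWeightedHomogeneous_monomial _ _ _ rfl
    obtain ⟨a, ha, g, hahom, hghom, hag⟩ := exists_homogeneous_decomposition hFhom hhom (hS m)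
    set ι : K →+* A := algebraMap K A with hι
    have hφι : (φ : A →+* K).comp ι = RingHom.id K := by
      ext x
      exact φ.commutes x
    set ε := monomial m (1 : A) - map ι a - ∑ l, map ι (g l) * pderiv l F with hε
    have hε0 : map (φ : A →+* K) ε = 0 := by
      rw [hε, map_sub, map_sub, map_sum, map_map, hφι, map_id, map_monomial, map_one, hag]
      simp only [map_mul, map_map, hφι, map_id, pderiv_map]
      ring
    have hεhom : IsWeightedHomogeneous w ε (Finsupp.weight w m) := by
      refine ((isWeightedHomogeneous_monomial _ _ _ rfl).sub
        (isWeightedHomogeneous_map ι hahom)).sub (IsWeightedHomogeneous.sum _ _ _ fun l _ => ?_)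
      have := (isWeightedHomogeneous_map ι (hghom l)).mul
        (hF.pderiv (i := l) (sub_add_cancel L (w l)))
      rwa [sub_add_cancel] at this
    have hεP : ε ∈ P := fun m' hm' => (hεhom (mem_support_iff.1 hm')).trans_le hmD
    have hεP' : ε ∈ RingHom.ker φ • P := by
      rw [ε.as_sum]
      refine Submodule.sum_mem _ fun m' hm' => ?_
      rw [← mul_one (coeff m' ε), ← smul_eq_mul, ← smul_monomial]
      refine Submodule.smul_mem_smul ?_ ?_
      · have := congrArg (coeff m') hε0
        rwa [coeff_map, coeff_zero] at this
      · rw [monomial_mem_restrictSupport]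
        exact Or.inl (hεP hm')
    have h1 : T.mkQ (monomial m 1) = T.mkQ ε := by
      rw [Submodule.mkQ_apply, Submodule.mkQ_apply, Submodule.Quotient.eq]
      have h2 : monomial m 1 - ε = map ι a + ∑ l, map ι (g l) * pderiv l F := by
        rw [hε]
        ring
      rw [h2]
      refine Submodule.add_mem_sup (fun s hs => ha (support_map_subset _ _ hs)) ?_
      exact sum_mem fun l _ => Ideal.mul_mem_left _ _ (Ideal.subset_span ⟨l, rfl⟩)
    rw [Submodule.mem_comap, h1, ← Submodule.map_smul'']
    exact Submodule.mem_map_of_mem hεP'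
  obtain ⟨h, hh, hh0⟩ := Submodule.exists_sub_one_mem_and_smul_eq_zero_of_fg_of_le_smul _ _
    (hfg.map _) hle
  refine ⟨h, ?_, fun m hm => ?_⟩
  · rw [RingHom.mem_ker, map_sub, map_one] at hh
    exact sub_eq_zero.1 hh
  · have h1 := hh0 (T.mkQ (monomial m 1)) (Submodule.mem_map_of_mem
      ((monomial_mem_restrictSupport A).2 (Or.inl hm)))
    rw [← map_smul, Submodule.mkQ_apply, Submodule.Quotient.mk_eq_zero] at h1
    exact h1

end Nakayama

end LandauGinzburg

namespace LandauGinzburg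

open MvPolynomial

/-! ### Base change and local monomial bases. -/

section Component

variable {n : ℕ} {w : Fin n → ℤ} {B B' : Type} [CommRing B] [CommRing B']

theorem map_weightedHomogeneousComponent (ψ : B →+* B') (d : ℤ) (p : MvPolynomial (Fin n) B) :
    map ψ (weightedHomogeneousComponent w d p) = weightedHomogeneousComponent w d (map ψ p) := by
  ext m
  rw [coeff_map, coeff_weightedHomogeneousComponent, coeff_weightedHomogeneousComponent, coeff_map]
  split_ifs <;> simp

theorem map_twistedDiv (ψ : B →+* B') (z : B) (f : MvPolynomial (Fin n) B)
    (g : Fin n → MvPolynomial (Fin n) B) :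
    map ψ (twistedDiv B n z f g) = twistedDiv B' n (ψ z) (map ψ f) fun l => map ψ (g l) := by
  simp only [twistedDiv_apply, map_sum, map_add, map_mul, smul_eq_C_mul, map_C, pderiv_map]

theorem map_mem_ltDeg (ψ : B →+* B') {d : ℤ} {p : MvPolynomial (Fin n) B}
    (hp : p ∈ ltDeg B w d) : map ψ p ∈ ltDeg B' w d :=
  fun _ hm => hp (support_map_subset _ _ hm)

/-- The ideal generated by the partial derivatives of the component of degree `L`. -/
def leadJac (w : Fin n → ℤ) (L : ℤ) (f : MvPolynomial (Fin n) B) : Ideal (MvPolynomial (Fin n) B) :=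
  Ideal.span (Set.range fun l => pderiv l (weightedHomogeneousComponent w L f))

theorem map_mem_leadJac (ψ : B →+* B') {L : ℤ} {f p : MvPolynomial (Fin n) B}
    (hp : p ∈ leadJac w L f) : map ψ p ∈ leadJac w L (map ψ f) := by
  obtain ⟨c, rfl⟩ := Ideal.mem_span_range_iff_exists_fun.1 hp
  rw [map_sum]
  refine sum_mem fun l _ => ?_
  rw [map_mul, ← pderiv_map, map_weightedHomogeneousComponent]
  exact Ideal.mul_mem_left _ _ (Ideal.subset_span ⟨l, rfl⟩)

theorem monomial_mem_awaySat_map (ψ : B →+* B') {L : ℤ} {f : MvPolynomial (Fin n) B}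
    {S : Set (Fin n →₀ ℕ)} {h : B} {m : Fin n →₀ ℕ}
    (hm : monomial m (1 : B) ∈
      awaySat h (restrictSupport B S ⊔ (leadJac w L f).restrictScalars B)) :
    monomial m (1 : B') ∈
      awaySat (ψ h) (restrictSupport B' S ⊔ (leadJac w L (map ψ f)).restrictScalars B') := by
  obtain ⟨k, hk⟩ := hm
  obtain ⟨a, ha, b, hb, hab⟩ := Submodule.mem_sup.1 hk
  refine ⟨k, ?_⟩
  have h1 := congrArg (map ψ) hab
  rw [smul_monomial, map_monomial, smul_eq_mul, mul_one, map_pow, map_add] at h1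
  rw [smul_monomial, smul_eq_mul, mul_one, ← h1]
  exact Submodule.add_mem_sup (fun s hs => ha (support_map_subset _ _ hs)) (map_mem_leadJac ψ hb)

end Component

section LocalBasis

variable {n : ℕ} {w : Fin n → ℤ} {v e : Fin n → ℕ} {K : Type} [Field K]

/-- `f` has weight at most `L` and the partial derivatives of its component of degree `L` form a
weakly regular sequence. -/
def HasRegularLead (w : Fin n → ℤ) (L : ℤ) (f : MvPolynomial (Fin n) K) : Prop :=
  RegSeq (extendZero fun l => pderiv l (weightedHomogeneousComponent w L f)) n

/-- The data of a family `f` of polynomials over `A`, a function `h` on the base and exponents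
`S`, such that the monomials with exponents in `S` are a basis wherever `h ≠ 0`. -/
structure IsLocalBasis {A : Type} [CommRing A] [Algebra K A] (w : Fin n → ℤ) (L : ℤ)
    (f : MvPolynomial (Fin n) A) (S : Finset (Fin n →₀ ℕ)) (h : A) : Prop where
  span : ∀ m, monomial m (1 : A) ∈ awaySat h
    (restrictSupport A (S : Set (Fin n →₀ ℕ)) ⊔ (leadJac w L f).restrictScalars A)
  regular : ∀ φ : A →ₐ[K] K, φ h ≠ 0 → HasRegularLead w L (map (φ : A →+* K) f)
  indep : ∀ φ : A →ₐ[K] K, φ h ≠ 0 → ∀ a ∈ restrictSupport K (S : Set (Fin n →₀ ℕ)),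
    a ∈ leadJac w L (map (φ : A →+* K) f) → a = 0

/-- The monomial basis at `φ` spans wherever `h ≠ 0`. The expected series depends only on the
degrees, not on the point, so the count made at `φ` forces regularity and independence at every
other such point. -/
theorem exists_isLocalBasis {A : Type} [CommRing A] [Algebra K A] {L : ℕ}
    (hv : ∀ i, 0 < v i) (he : ∀ i, 0 < e i) (hwv : ∀ i, w i = v i) (hve : ∀ i, v i + e i = L)
    (f : MvPolynomial (Fin n) A) (φ : A →ₐ[K] K)
    (hφ : HasRegularLead w L (map (φ : A →+* K) f)) :
    ∃ (S : Finset (Fin n →₀ ℕ)) (h : A), φ h = 1 ∧ S.card * ∏ i, v i = ∏ i, e i ∧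
      IsLocalBasis (K := K) w L f S h := by
  have hw : ∀ i, 0 < w i := fun i => by rw [hwv]; exact_mod_cast hv i
  have hhom : ∀ (f : MvPolynomial (Fin n) K) (i : Fin n),
      IsWeightedHomogeneous w (pderiv i (weightedHomogeneousComponent w L f)) (e i : ℤ) := by
    intro f i
    refine (weightedHomogeneousComponent_isWeightedHomogeneous _ f).pderiv ?_
    rw [hwv, ← hve i]
    push_cast
    ring
  obtain ⟨S, hS, hcard, hprod⟩ := exists_monomialBasis hv hwv (hhom _) hφ
  -- Large enough that multiplying any monomial of `S` by a variable stays in weight at most `D`, as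
  -- each variable has weight at most `L`.
  set D : ℤ := ∑ s ∈ S, Finsupp.weight w s + L with hD
  have hnn : ∀ s ∈ S, 0 ≤ Finsupp.weight w s := fun s _ => weight_nonneg hw s
  obtain ⟨h, hφh, hh⟩ := exists_smul_mem_of_spansMod hw φ
    (weightedHomogeneousComponent_isWeightedHomogeneous (w := w) (L : ℤ) f) (S := S)
    (by simpa only [map_weightedHomogeneousComponent] using hS) D
  have hspan : ∀ m, monomial m (1 : A) ∈ awaySat h
      (restrictSupport A (S : Set (Fin n →₀ ℕ)) ⊔ (leadJac w L f).restrictScalars A) := by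
    intro m
    refine mem_awaySat_of_bounded (w := w) (D := D) ?_ h ?_ (fun m hm => ⟨1, ?_⟩) _
    · exact add_nonneg (Finset.sum_nonneg hnn) (Int.natCast_nonneg _)
    · intro s hs i
      have h1 := Finset.single_le_sum hnn hs
      have h2 := hve i
      have h3 := hwv i
      omega
    · rw [pow_one]
      exact hh m hm
  have key : ∀ χ : A →ₐ[K] K, χ h ≠ 0 → HasRegularLead w L (map (χ : A →+* K) f) ∧
      ∀ a ∈ restrictSupport K (S : Set (Fin n →₀ ℕ)),
        a ∈ leadJac w L (map (χ : A →+* K) f) → a = 0 := by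
    intro χ hχ
    refine regSeq_of_spansMod hv hwv (hhom _) he (fun m => ?_) hcard
    obtain ⟨k, hk⟩ := monomial_mem_awaySat_map (χ : A →+* K) (hspan m)
    exact (Submodule.smul_mem_iff _ (pow_ne_zero k hχ)).1 hk
  exact ⟨S, h, hφh, hprod, hspan, fun χ hχ => (key χ hχ).1, fun χ hχ => (key χ hχ).2⟩

variable {A B : Type} [CommRing A] [Algebra K A] [CommRing B] {L : ℤ} {f : MvPolynomial (Fin n) A}
  {S : Finset (Fin n →₀ ℕ)} {h : A}

/-- Spanning survives base change, so no passage to points is needed here. -/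
theorem IsLocalBasis.mem_awaySat (hS : IsLocalBasis (K := K) w L f S h)
    (hw : ∀ i, 0 < w i) (hL : 0 < L) (hf : f ∈ ltDeg A w (L + 1)) (ψ : A →+* B) (z : B)
    (p : MvPolynomial (Fin n) B) :
    p ∈ awaySat (ψ h) (restrictSupport B (S : Set (Fin n →₀ ℕ)) ⊔
      LinearMap.range (twistedDiv B n z (map ψ f))) :=
  mem_awaySat_twistedDiv hw hL z (map_mem_ltDeg ψ hf) (ψ h)
    (fun m => monomial_mem_awaySat_map ψ (hS.span m)) p

/-- Independence is known at K-points only. A relation over `B` specializes to a relation at each of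
them, so every coefficient vanishes there, and `hsep` says that such specializations detect zero. -/
theorem IsLocalBasis.eq_zero (hS : IsLocalBasis (K := K) w L f S h)
    (hw : ∀ i, 0 < w i) (hwL : ∀ i, w i < L) (hf : f ∈ ltDeg A w (L + 1)) (ψ : A →+* B) (z : B)
    (hsep : ∀ b : B, (∀ (χ : B →+* K) (φ : A →ₐ[K] K), χ.comp ψ = (φ : A →+* K) → φ h ≠ 0 →
      χ b = 0) → b = 0)
    {a : MvPolynomial (Fin n) B} (ha : a ∈ restrictSupport B (S : Set (Fin n →₀ ℕ)))
    (hrange : a ∈ LinearMap.range (twistedDiv B n z (map ψ f))) : a = 0 := by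
  ext m
  rw [coeff_zero]
  refine hsep _ fun χ φ hχ hφ => ?_
  obtain ⟨g, rfl⟩ := hrange
  have hf' : map χ (map ψ f) = map (φ : A →+* K) f := by rw [map_map, hχ]
  have h0 := eq_zero_of_mem_range_twistedDiv hw hwL (χ z) (map_mem_ltDeg (φ : A →+* K) hf)
    (hS.regular φ hφ) (hS.indep φ hφ) (a := map χ (twistedDiv B n z (map ψ f) g))
    (fun s hs => ha (support_map_subset _ _ hs))
    (by rw [map_twistedDiv, hf']; exact ⟨_, rfl⟩)
  rw [← coeff_map, h0, coeff_zero]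

/-- Monomials which are independent modulo `T` and span modulo `T` up to powers of `h` give a basis
of the quotient by `T` away from `h`. -/
theorem linearIndependent_and_span {M : Type} [AddCommGroup M] [Module B M]
    (q : MvPolynomial (Fin n) B →ₗ[B] M) (hq : Function.Surjective q)
    (hind : ∀ a ∈ restrictSupport B (S : Set (Fin n →₀ ℕ)), a ∈ LinearMap.ker q → a = 0) {h : B}
    (hspan : ∀ p, p ∈ awaySat h (restrictSupport B (S : Set (Fin n →₀ ℕ)) ⊔ LinearMap.ker q))
    {N : ℕ} (hN : S.card = N) :
    ∃ v : Fin N → M, LinearIndependent B v ∧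
      ∀ x : M, ∃ k : ℕ, h ^ k • x ∈ Submodule.span B (Set.range v) := by
  let ε : Fin N ≃ S := (finCongr hN.symm).trans S.equivFin.symm
  refine ⟨fun i => q (monomial (ε i) 1), ?_, ?_⟩
  · rw [Fintype.linearIndependent_iff]
    intro c hc i
    have h1 : ∑ j, c j • monomial (ε j).1 (1 : B) = 0 := by
      refine hind _ (Submodule.sum_mem _ fun j _ => Submodule.smul_mem _ _ ?_) ?_
      · exact (monomial_mem_restrictSupport B).2 (Or.inl (ε j).2)
      · rw [LinearMap.mem_ker, map_sum, ← hc]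
        simp only [map_smul]
    have h2 := congrArg (coeff (ε i).1) h1
    rw [coeff_sum, Finset.sum_eq_single i, coeff_smul, coeff_monomial, if_pos rfl] at h2
    · simpa using h2
    · intro j _ hj
      rw [coeff_smul, coeff_monomial, if_neg fun h => hj (ε.injective (Subtype.ext h)), smul_zero]
    · simp
  · intro x
    obtain ⟨p, rfl⟩ := hq x
    obtain ⟨k, hk⟩ := hspan p
    refine ⟨k, ?_⟩
    obtain ⟨a, ha, b, hb, hab⟩ := Submodule.mem_sup.1 hk
    rw [← map_smul, ← hab, map_add, LinearMap.mem_ker.1 hb, add_zero]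
    rw [restrictSupport_eq_span] at ha
    have h1 := Submodule.mem_map_of_mem (f := q) ha
    rw [Submodule.map_span] at h1
    refine Submodule.span_mono ?_ h1
    rintro _ ⟨_, ⟨s, hs, rfl⟩, rfl⟩
    exact ⟨ε.symm ⟨s, hs⟩, by simp⟩

end LocalBasis

end LandauGinzburg

namespace LandauGinzburg

/-! ### The parameter space 𝓜 and its points. -/

namespace WeightSystem

open MvPolynomial

variable {n : ℕ} (W : WeightSystem n)

/-- The weights `vᵢ = L cᵢ` and the degrees `eᵢ = L (1 - cᵢ)` of the partial derivatives are
positive integers. -/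
structure IsRescaling (v e : Fin n → ℕ) (L : ℕ) : Prop where
  pos : 0 < L
  v_pos : ∀ i, 0 < v i
  e_pos : ∀ i, 0 < e i
  add : ∀ i, v i + e i = L
  mul : ∀ i, W.c i * L = v i

theorem exists_isRescaling : ∃ v e L, W.IsRescaling v e L := by
  -- Any common denominator of the weights would serve.
  set L : ℕ := ∏ i, (W.c i).den with hL
  have hL0 : 0 < L := Finset.prod_pos fun i _ => (W.c i).den_pos
  have hLQ : (0 : ℚ) < L := by exact_mod_cast hL0
  have h1 : ∀ i, ∃ k : ℕ, W.c i * L = k := by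
    intro i
    obtain ⟨d, hd⟩ : (W.c i).den ∣ L := Finset.dvd_prod_of_mem _ (Finset.mem_univ i)
    have h2 : W.c i * L = ((W.c i).num * d : ℤ) := by
      rw [hd]
      push_cast
      rw [← mul_assoc, Rat.mul_den_eq_num]
    have h3 : (0 : ℤ) ≤ (W.c i).num * d :=
      mul_nonneg (Rat.num_nonneg.2 (W.pos i).le) (Int.natCast_nonneg d)
    obtain ⟨k, hk⟩ := Int.eq_ofNat_of_zero_le h3
    exact ⟨k, by rw [h2, hk]; simp⟩
  choose v hv using h1
  have hlt : ∀ i, v i < L := fun i => by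
    have : (v i : ℚ) < L := by
      rw [← hv]
      exact mul_lt_of_lt_one_left hLQ (W.lt_one i)
    exact_mod_cast this
  refine ⟨v, fun i => L - v i, L, hL0, fun i => ?_, fun i => Nat.sub_pos_of_lt (hlt i),
    fun i => Nat.add_sub_cancel' (hlt i).le, hv⟩
  have : (0 : ℚ) < v i := by
    rw [← hv]
    exact mul_pos (W.pos i) hLQ
  exact_mod_cast this

variable {W} {v e : Fin n → ℕ} {L : ℕ}

namespace IsRescaling

theorem weight_eq (h : W.IsRescaling v e L) (m : Fin n →₀ ℕ) :
    ((Finsupp.weight (fun i => (v i : ℤ)) m : ℤ) : ℚ) = Finsupp.weight W.c m * L := by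
  rw [Finsupp.weight_apply, Finsupp.weight_apply, Finsupp.sum, Finsupp.sum, Finset.sum_mul]
  push_cast
  refine Finset.sum_congr rfl fun i _ => ?_
  rw [smul_mul_assoc, h.mul]
  simp

theorem weight_eq_iff (h : W.IsRescaling v e L) (m : Fin n →₀ ℕ) :
    Finsupp.weight W.c m = 1 ↔ Finsupp.weight (fun i => (v i : ℤ)) m = L := by
  have hL : (L : ℚ) ≠ 0 := by exact_mod_cast h.pos.ne'
  rw [← mul_left_inj' hL, ← h.weight_eq, one_mul]
  norm_cast

theorem weight_le_iff (h : W.IsRescaling v e L) (m : Fin n →₀ ℕ) :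
    Finsupp.weight W.c m ≤ 1 ↔ Finsupp.weight (fun i => (v i : ℤ)) m ≤ L := by
  have hL : (0 : ℚ) < L := by exact_mod_cast h.pos
  rw [← mul_le_mul_iff_left₀ hL, ← h.weight_eq, one_mul]
  norm_cast

theorem weight_pos (h : W.IsRescaling v e L) (i : Fin n) : 0 < (v i : ℤ) := by
  exact_mod_cast h.v_pos i

theorem weight_lt (h : W.IsRescaling v e L) (i : Fin n) : (v i : ℤ) < L := by
  have h1 := h.add i
  have h2 := h.e_pos i
  omega

theorem component_eq {R : Type} [CommRing R] (h : W.IsRescaling v e L)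
    (p : MvPolynomial (Fin n) R) :
    weightedHomogeneousComponent W.c 1 p =
      weightedHomogeneousComponent (fun i => (v i : ℤ)) (L : ℤ) p := by
  ext m
  simp only [coeff_weightedHomogeneousComponent, h.weight_eq_iff]

/-- Regular differs from weakly regular by properness of the ideal, which is automatic: the partial
derivatives have positive degree and vanish at the origin. -/
theorem isRegularMarginal_component_iff (h : W.IsRescaling v e L) (p : MvPolynomial (Fin n) ℂ) :
    W.IsRegularMarginal (weightedHomogeneousComponent W.c 1 p) ↔
      HasRegularLead (fun i => (v i : ℤ)) L p := by
  rw [HasRegularLead, ← h.component_eq, ← isWeaklyRegular_ofFn_iff]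
  refine ⟨fun hp => hp.2.toIsWeaklyRegular, fun hp =>
    ⟨weightedHomogeneousComponent_isWeightedHomogeneous _ p, hp, ?_⟩⟩
  have hle : Ideal.ofList (List.ofFn fun i => pderiv i (weightedHomogeneousComponent W.c 1 p)) ≤
      RingHom.ker (constantCoeff (R := ℂ) (σ := Fin n)) := by
    refine Ideal.span_le.2 fun q hq => ?_
    obtain ⟨i, rfl⟩ := (List.mem_ofFn' _ _).1 hq
    rw [SetLike.mem_coe, RingHom.mem_ker, constantCoeff_eq, h.component_eq]
    have hhom : IsWeightedHomogeneous (fun i => (v i : ℤ))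
        (pderiv i (weightedHomogeneousComponent (fun i => (v i : ℤ)) (L : ℤ) p)) (e i : ℤ) := by
      refine (weightedHomogeneousComponent_isWeightedHomogeneous _ p).pderiv ?_
      rw [← h.add i]
      push_cast
      ring
    refine hhom.coeff_eq_zero 0 ?_
    rw [map_zero]
    exact_mod_cast (h.e_pos i).ne
  intro htop
  have h1 : (1 : MvPolynomial (Fin n) ℂ) ∈ RingHom.ker (constantCoeff (R := ℂ) (σ := Fin n)) := by
    apply hle
    rw [smul_eq_mul, Ideal.mul_top] at htop
    rw [← htop]
    trivial
  rw [RingHom.mem_ker, map_one] at h1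
  exact one_ne_zero h1

/-- A single polynomial is treated as a family over ℂ itself; this yields the integrality of N. -/
theorem exists_card_mul_prod_eq (h : W.IsRescaling v e L) {g : MvPolynomial (Fin n) ℂ}
    (hg : W.IsRegularMarginal g) :
    ∃ S : Finset (Fin n →₀ ℕ), S.card * ∏ i, v i = ∏ i, e i := by
  have hcomp : weightedHomogeneousComponent W.c 1 g = g := hg.1.weightedHomogeneousComponent_same
  have hreg := (h.isRegularMarginal_component_iff g).1 (by rwa [hcomp])
  obtain ⟨S, -, -, hcard, -⟩ := exists_isLocalBasis (A := ℂ) h.v_pos h.e_pos (fun _ => rfl) h.add g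
    (AlgHom.id ℂ ℂ) (by
      rw [show ((AlgHom.id ℂ ℂ : ℂ →ₐ[ℂ] ℂ) : ℂ →+* ℂ) = RingHom.id ℂ from rfl, map_id]
      exact hreg)
  exact ⟨S, hcard⟩

theorem card_eq (h : W.IsRescaling v e L) {S : Finset (Fin n →₀ ℕ)}
    (hS : S.card * ∏ i, v i = ∏ i, e i) : (S.card : ℚ) = ∏ i, (1 - W.c i) / W.c i := by
  have hL : (L : ℚ) ≠ 0 := by exact_mod_cast h.pos.ne'
  have h1 : ∀ i, (1 - W.c i) / W.c i = e i / v i := fun i => by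
    rw [← h.mul i, ← mul_div_mul_right _ _ hL, sub_mul, h.mul i, one_mul, ← h.add i]
    push_cast
    ring
  rw [Finset.prod_congr rfl fun i _ => h1 i, Finset.prod_div_distrib, eq_div_iff]
  · exact_mod_cast hS
  · exact Finset.prod_ne_zero_iff.2 fun i _ => by exact_mod_cast (h.v_pos i).ne'

end IsRescaling

section Poly

variable {R R' : Type} [CommRing R] [CommRing R']

theorem support_poly (t : W.Exps → R) {m : Fin n →₀ ℕ} (hm : m ∈ (W.poly t).support) :
    0 < Finsupp.weight W.c m ∧ Finsupp.weight W.c m ≤ 1 := by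
  classical
  obtain ⟨k, -, hk⟩ := Finset.mem_biUnion.1 (support_sum hm)
  rw [Finset.mem_singleton.1 (support_monomial_subset hk)]
  exact k.2

theorem map_poly (ψ : R →+* R') (t : W.Exps → R) :
    map ψ (W.poly t) = W.poly fun m => ψ (t m) := by
  simp [poly]

theorem map_universalPoly (t : W.Exps → ℂ) :
    map (aeval t : W.Coord →ₐ[ℂ] ℂ) W.universalPoly = W.poly t := by
  rw [universalPoly, map_poly]
  simp

theorem IsRescaling.poly_mem_ltDeg (h : W.IsRescaling v e L) (t : W.Exps → R) :
    W.poly t ∈ ltDeg R (fun i => (v i : ℤ)) (L + 1) :=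
  mem_ltDeg.2 fun m hm => Int.lt_add_one_of_le ((h.weight_le_iff m).1 (support_poly t hm).2)

theorem IsRescaling.poly_mem_polySet_iff (h : W.IsRescaling v e L) (t : W.Exps → ℂ) :
    W.poly t ∈ W.polySet ↔ HasRegularLead (fun i => (v i : ℤ)) L (W.poly t) := by
  rw [← h.isRegularMarginal_component_iff]
  exact ⟨fun H => H.2, fun H => ⟨fun m hm => support_poly t hm, H⟩⟩

end Poly

theorem point_mem_basicOpen (t : W.Exps → ℂ) (a : W.Coord) :
    W.point t ∈ (PrimeSpectrum.basicOpen a : W.Param.Opens) ↔ eval t a ≠ 0 :=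
  Iff.rfl

/-- The monomials with exponents in `S` are a basis of the Jacobian ring where `h ≠ 0`. -/
abbrev LocalBasis (W : WeightSystem n) (v : Fin n → ℕ) (L : ℕ) (S : Finset (Fin n →₀ ℕ))
    (h : W.Coord) : Prop :=
  IsLocalBasis (K := ℂ) (fun i => (v i : ℤ)) L W.universalPoly S h

theorem IsRescaling.basicOpen_le_modSpace (hW : W.IsRescaling v e L) {S : Finset (Fin n →₀ ℕ)}
    {h : W.Coord} (hS : W.LocalBasis v L S h) :
    (PrimeSpectrum.basicOpen h : W.Param.Opens) ≤ W.modSpace := by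
  refine le_sSup fun t ht => ?_
  rw [hW.poly_mem_polySet_iff, ← map_universalPoly]
  exact hS.regular _ ht

theorem IsRescaling.exists_localBasis (hW : W.IsRescaling v e L) {t : W.Exps → ℂ}
    (ht : W.poly t ∈ W.polySet) :
    ∃ (S : Finset (Fin n →₀ ℕ)) (h : W.Coord), eval t h = 1 ∧ S.card * ∏ i, v i = ∏ i, e i ∧
      W.LocalBasis v L S h := by
  rw [hW.poly_mem_polySet_iff, ← map_universalPoly] at ht
  exact exists_isLocalBasis hW.v_pos hW.e_pos (fun _ => rfl) hW.add W.universalPoly _ ht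

theorem poly_mem_of_point_mem {t : W.Exps → ℂ} (ht : W.point t ∈ W.modSpace) :
    W.poly t ∈ W.polySet := by
  obtain ⟨U, hU, htU⟩ := TopologicalSpace.Opens.mem_sSup.1 ht
  exact hU t htU

/-- The substance is openness: around a good point the set h ≠ 0 of a local basis consists of good
points. -/
theorem point_mem_modSpace_iff (t : W.Exps → ℂ) :
    W.point t ∈ W.modSpace ↔ W.poly t ∈ W.polySet := by
  refine ⟨poly_mem_of_point_mem, fun ht => ?_⟩
  obtain ⟨v, e, L, hW⟩ := W.exists_isRescaling
  obtain ⟨S, h, hh, -, hS⟩ := hW.exists_localBasis ht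
  exact hW.basicOpen_le_modSpace hS ((point_mem_basicOpen t h).2 (by rw [hh]; exact one_ne_zero))

/-- Nullstellensatz: a prime ideal is the vanishing ideal of its zero locus. -/
theorem exists_eval_ne_zero (I : Ideal W.Coord) [I.IsPrime] {g : W.Coord} (hg : g ∉ I) :
    ∃ t : W.Exps → ℂ, (∀ a ∈ I, eval t a = 0) ∧ eval t g ≠ 0 := by
  have h1 : vanishingIdeal ℂ (zeroLocus ℂ I) = I := by
    rw [vanishingIdeal_zeroLocus_eq_radical, Ideal.IsPrime.radical ‹_›]
  rw [← h1, mem_vanishingIdeal_iff] at hg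
  push Not at hg
  obtain ⟨t, ht, hgt⟩ := hg
  exact ⟨t, fun a ha => by simpa using ht a ha, by simpa using hgt⟩

/-- Every scheme point of 𝓜 specializes to a ℂ-point of 𝓜, and any open neighbourhood of the latter
contains the former. This reduces local freeness to ℂ-points. -/
theorem exists_point_mem_of_mem_modSpace {x : W.Param} (hx : x ∈ W.modSpace) :
    ∃ t : W.Exps → ℂ, W.poly t ∈ W.polySet ∧
      ∀ h : W.Coord, eval t h ≠ 0 → x ∈ (PrimeSpectrum.basicOpen h : W.Param.Opens) := by
  obtain ⟨_, ⟨_, ⟨g, rfl⟩, rfl⟩, hxg, hg⟩ :=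
    PrimeSpectrum.isTopologicalBasis_basic_opens.exists_subset_of_mem_open hx W.modSpace.isOpen
  have : (PrimeSpectrum.asIdeal x).IsPrime := PrimeSpectrum.isPrime x
  obtain ⟨t, ht, hgt⟩ := exists_eval_ne_zero (PrimeSpectrum.asIdeal x) hxg
  exact ⟨t, poly_mem_of_point_mem (hg hgt), fun h hh hmem => hh (ht h hmem)⟩

theorem IsRescaling.exists_localBasis_of_mem (hW : W.IsRescaling v e L) {x : W.Param}
    (hx : x ∈ W.modSpace) :
    ∃ (S : Finset (Fin n →₀ ℕ)) (h : W.Coord), x ∈ (PrimeSpectrum.basicOpen h : W.Param.Opens) ∧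
      S.card * ∏ i, v i = ∏ i, e i ∧ W.LocalBasis v L S h := by
  obtain ⟨t, ht, hxt⟩ := exists_point_mem_of_mem_modSpace hx
  obtain ⟨S, h, hh, hcard, hS⟩ := hW.exists_localBasis ht
  exact ⟨S, h, hxt h (by rw [hh]; exact one_ne_zero), hcard, hS⟩

theorem eq_zero_of_eval_eq_zero {h : W.Coord} (hh : h ≠ 0) {b : W.Coord}
    (hb : ∀ t : W.Exps → ℂ, eval t h ≠ 0 → eval t b = 0) : b = 0 := by
  have h1 : b * h = 0 := by
    refine MvPolynomial.funext fun t => ?_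
    rw [map_mul, map_zero]
    by_cases ht : eval t h = 0
    · rw [ht, mul_zero]
    · rw [hb t ht, zero_mul]
  exact (mul_eq_zero.1 h1).resolve_right hh

theorem eq_zero_of_ringHom {h : W.Coord} (hh : h ≠ 0) (b : W.Coord)
    (hb : ∀ (χ : W.Coord →+* ℂ) (φ : W.Coord →ₐ[ℂ] ℂ),
      χ.comp (RingHom.id _) = (φ : W.Coord →+* ℂ) → φ h ≠ 0 → χ b = 0) : b = 0 :=
  eq_zero_of_eval_eq_zero hh fun t ht => hb _ (aeval t) rfl ht

/-- The separation hypothesis of `IsLocalBasis.eq_zero` for B = ℂ[t][z]: the value of z is free, so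
polynomials in z are tested at all complex numbers. -/
theorem polynomial_eq_zero_of_ringHom {h : W.Coord} (hh : h ≠ 0) (b : Polynomial W.Coord)
    (hb : ∀ (χ : Polynomial W.Coord →+* ℂ) (φ : W.Coord →ₐ[ℂ] ℂ),
      χ.comp Polynomial.C = (φ : W.Coord →+* ℂ) → φ h ≠ 0 → χ b = 0) : b = 0 := by
  ext1 k
  refine eq_zero_of_eval_eq_zero hh fun t ht => ?_
  have h1 : b.map (eval t) = 0 := by
    refine Polynomial.funext fun z => ?_
    rw [Polynomial.eval_zero, Polynomial.eval_map]
    refine hb (Polynomial.eval₂RingHom (eval t) z) (aeval t) ?_ ht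
    ext <;> simp
  rw [← Polynomial.coeff_map, h1, Polynomial.coeff_zero]

theorem exists_pow_smul_mem_of_basicOpen_le {A B M : Type} [CommRing A] [CommRing B]
    [AddCommGroup M] [Module B M] (ψ : A →+* B) {b h : A}
    (hb : PrimeSpectrum.basicOpen b ≤ PrimeSpectrum.basicOpen h) {T : Submodule B M}
    {x : M} (hx : ∃ k : ℕ, ψ h ^ k • x ∈ T) : ∃ k : ℕ, ψ b ^ k • x ∈ T := by
  -- Inclusion of basic opens means that `h` divides a power of `b`.
  obtain ⟨j, hj⟩ := (PrimeSpectrum.basicOpen_le_basicOpen_iff b h).1 hb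
  obtain ⟨c, hc⟩ := Ideal.mem_span_singleton.1 hj
  obtain ⟨k, hk⟩ := hx
  refine ⟨j * k, ?_⟩
  rw [pow_mul, ← map_pow, hc, map_mul, mul_comm, mul_pow, mul_smul]
  exact T.smul_mem _ hk

theorem IsRescaling.isLocallyFree_twistedSheaf (hW : W.IsRescaling v e L) {N : ℕ}
    (hN : ∀ S : Finset (Fin n →₀ ℕ), S.card * ∏ i, v i = ∏ i, e i → S.card = N) :
    IsLocallyFreeOfRankOver W.projZ W.twistedSheaf W.modSpace N := by
  refine isLocallyFreeOfRankOver_of_basicOpen _ _ _ fun x hx => ?_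
  obtain ⟨S, h, hxh, hcard, hS⟩ := hW.exists_localBasis_of_mem hx
  -- D(h) contains `x`, so it is non-empty.
  have hh : h ≠ 0 := fun h0 => hxh (h0 ▸ Ideal.zero_mem _)
  refine ⟨h, hxh, hW.basicOpen_le_modSpace hS, ?_⟩
  let q := (twistedDeRhamEquiv (Polynomial W.Coord) n Polynomial.X W.universalPolyZ).toLinearMap ∘ₗ
    (LinearMap.range (twistedDiv (Polynomial W.Coord) n Polynomial.X W.universalPolyZ)).mkQ
  have hq : LinearMap.ker q =
      LinearMap.range (twistedDiv (Polynomial W.Coord) n Polynomial.X W.universalPolyZ) := by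
    rw [LinearEquiv.ker_comp, Submodule.ker_mkQ]
  have hf := hW.poly_mem_ltDeg (fun m => (X m : W.Coord))
  obtain ⟨u, hind, hspan⟩ := linearIndependent_and_span (S := S) (h := Polynomial.C h) q
    ((twistedDeRhamEquiv _ n _ _).surjective.comp (Submodule.mkQ_surjective _))
    (fun a ha hk => hS.eq_zero hW.weight_pos hW.weight_lt hf Polynomial.C Polynomial.X
      (polynomial_eq_zero_of_ringHom hh) ha (hq ▸ hk))
    (by
      rw [hq]
      exact hS.mem_awaySat hW.weight_pos (by exact_mod_cast hW.pos) hf Polynomial.C Polynomial.X)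
    (hN S hcard)
  refine ⟨fun i => (tilde.toOpen (ModuleCat.of (CommRingCat.of (Polynomial W.Coord)) _) _).hom
      (u i),
    fun b hb => ?_⟩
  exact isBasisOn_tilde (ModuleCat.of (CommRingCat.of (Polynomial W.Coord))
    (TwistedDeRham (Polynomial W.Coord) n Polynomial.X W.universalPolyZ)) (Polynomial.C b) rfl _
    u hind fun x => exists_pow_smul_mem_of_basicOpen_le Polynomial.C hb (hspan x)

/-- At z = 0 the twisted differential is multiplication by the partial derivatives, so the Jacobi
ring is a case of the same construction. -/
theorem range_twistedDiv_zero (B : Type) [CommRing B] (f : MvPolynomial (Fin n) B) :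
    LinearMap.range (twistedDiv B n 0 f) =
      (Ideal.span (Set.range fun i => pderiv i f)).restrictScalars B := by
  ext p
  rw [LinearMap.mem_range, Submodule.restrictScalars_mem, Ideal.mem_span_range_iff_exists_fun]
  simp only [twistedDiv_apply, zero_smul, add_zero]

/-- `hφ` reconciles the module structure induced by `φ` with the given algebra instance, in which
independence is stated. -/
theorem isLocallyFreeOfRankOver_pushforward_unit {R Q : Type} [CommRing R] [CommRing Q]
    [Algebra R Q] (φ : CommRingCat.of R ⟶ CommRingCat.of Q) (hφ : φ.hom = algebraMap R Q) {N : ℕ}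
    (M : (Spec (CommRingCat.of R)).Opens)
    (h : ∀ x ∈ M, ∃ a : R, x ∈ (PrimeSpectrum.basicOpen a : (Spec (CommRingCat.of R)).Opens) ∧
      (PrimeSpectrum.basicOpen a : (Spec (CommRingCat.of R)).Opens) ≤ M ∧
      ∃ v : Fin N → Q, LinearIndependent R v ∧
        ∀ x : Q, ∃ k : ℕ, a ^ k • x ∈ Submodule.span R (Set.range v)) :
    IsLocallyFreeOfRankOver (𝟙 (Spec (CommRingCat.of R)))
      ((Scheme.Modules.pushforward (Spec.map φ)).obj
        (SheafOfModules.unit (Spec (CommRingCat.of Q)).ringCatSheaf :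
          (Spec (CommRingCat.of Q)).Modules)) M N := by
  have halg : φ.hom.toAlgebra = ‹Algebra R Q› := Algebra.algebra_ext _ _ fun r => congrArg (· r) hφ
  subst halg
  refine isLocallyFreeOfRankOver_of_basicOpen _ _ _ fun x hx => ?_
  obtain ⟨a, hxa, ha, v, hv, hspan⟩ := h x hx
  refine ⟨a, hxa, ha, _, fun b hb => isBasisOn_pushforward_unit φ b rfl hb v hv fun x => ?_⟩
  let : Algebra R (CommRingCat.of Q) := φ.hom.toAlgebra
  exact exists_pow_smul_mem_of_basicOpen_le (RingHom.id R) hb (hspan x)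

theorem IsRescaling.isLocallyFree_jacobiSheaf (hW : W.IsRescaling v e L) {N : ℕ}
    (hN : ∀ S : Finset (Fin n →₀ ℕ), S.card * ∏ i, v i = ∏ i, e i → S.card = N) :
    IsLocallyFreeOfRankOver (𝟙 W.Param) W.jacobiSheaf W.modSpace N := by
  have hφ : (Ideal.Quotient.mk W.jacIdeal).comp C =
      algebraMap W.Coord (MvPolynomial (Fin n) W.Coord ⧸ W.jacIdeal) := rfl
  have hloc := isLocallyFreeOfRankOver_pushforward_unit (R := W.Coord) (N := N)
    (Q := MvPolynomial (Fin n) W.Coord ⧸ W.jacIdeal)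
    (CommRingCat.ofHom ((Ideal.Quotient.mk W.jacIdeal).comp C))
  refine hloc hφ W.modSpace fun x hx => ?_
  obtain ⟨S, h, hxh, hcard, hS⟩ := hW.exists_localBasis_of_mem hx
  have hh : h ≠ 0 := fun h0 => hxh (h0 ▸ Ideal.zero_mem _)
  refine ⟨h, hxh, hW.basicOpen_le_modSpace hS, ?_⟩
  let q := (Ideal.Quotient.mkₐ W.Coord W.jacIdeal).toLinearMap
  have hq : LinearMap.ker q = LinearMap.range (twistedDiv W.Coord n 0
      (map (RingHom.id W.Coord) W.universalPoly)) := by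
    ext p
    rw [range_twistedDiv_zero, map_id]
    exact Ideal.Quotient.eq_zero_iff_mem
  have hf := hW.poly_mem_ltDeg (fun m => (X m : W.Coord))
  exact linearIndependent_and_span (S := S) (h := h) q Ideal.Quotient.mk_surjective
    (fun a ha hk => hS.eq_zero hW.weight_pos hW.weight_lt hf (RingHom.id _) 0
      (eq_zero_of_ringHom hh) ha (hq ▸ hk))
    (by
      rw [hq]
      exact hS.mem_awaySat hW.weight_pos (by exact_mod_cast hW.pos) hf (RingHom.id _) 0)
    (hN S hcard)

end WeightSystem

end LandauGinzburg

end

theorem propositionH (n : ℕ) (W : LandauGinzburg.WeightSystem n)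
    (hne : ∃ g : MvPolynomial (Fin n) ℂ, W.IsRegularMarginal g) :
    (∀ t : W.Exps → ℂ, W.point t ∈ W.modSpace ↔ W.poly t ∈ W.polySet) ∧
    ∃ N : ℕ, (N : ℚ) = ∏ i, (1 - W.c i) / W.c i ∧
      LandauGinzburg.IsLocallyFreeOfRankOver W.projZ W.twistedSheaf W.modSpace N ∧
      LandauGinzburg.IsLocallyFreeOfRankOver (𝟙 W.Param) W.jacobiSheaf W.modSpace N := by
  obtain ⟨v, e, L, hW⟩ := W.exists_isRescaling
  obtain ⟨g, hg⟩ := hne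
  obtain ⟨S, hS⟩ := hW.exists_card_mul_prod_eq hg
  have hv : 0 < ∏ i, v i := Finset.prod_pos fun i _ => hW.v_pos i
  -- Different points may need different monomials; cancelling ∏ v i shows that the rank is the same
  -- throughout.
  have hN : ∀ S' : Finset (Fin n →₀ ℕ), S'.card * ∏ i, v i = ∏ i, e i → S'.card = S.card :=
    fun S' hS' => Nat.eq_of_mul_eq_mul_right hv (hS'.trans hS.symm)
  exact ⟨LandauGinzburg.WeightSystem.point_mem_modSpace_iff, S.card, hW.card_eq hS,
    hW.isLocallyFree_twistedSheaf hN, hW.isLocallyFree_jacobiSheaf hN⟩
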